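/- Let $\Lambda=\mathbb Z+i\mathbb Z$, write $m_1=\operatorname{Re}m$, $m_2=\operatorname{Im}m$ for $m\in\Lambda$, and let $S_0=(0,1)\times(0,1)\subset\mathbb C$. Let the periodic cell $\varpi\subset S_0$ be a domain (nonempty, open, connected) such that $\partial S_0\subset\partial\varpi$ and $S_0\setminus\overline{\varpi}$ contains a nonempty open set. Put $\varpi_m=\varpi+m$, and let $\Omega$ be the interior of $\bigcup_{m\in\Lambda}\overline{\varpi_m}$. Assume that $\Omega\setminus\bigcup_{m}\varpi_m$ has area zero, and that $\Omega$ satisfies the following condition. $(\mathcal A)$ There is an elliptic function $\varphi$ with $\varphi(z)=\varphi(z+1)=\varphi(z+i)$, all of whose zeros lie in $\mathbb C\setminus\overline\Omega$, and a meromorphic function $\phi$ on $\mathbb C$ with only finitely many poles, all in $S_0$, such that $\varphi(z)=\sum_{m\in\Lambda}\phi(z-m)$ for all $z$ outside the $\Lambda$-translates of the poles of $\phi$, and $\sup_{z\in\Omega\setminus\overline{S_0}}(1+|z|)^b|\phi(z)|<\infty$ for some $b>2$. For open $D\subset\mathbb C$ let $A^2(D)$ be the subspace of analytic functions in $L^2(D)$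 (area measure), and let $\mathbf Q=[-\pi,\pi]^2$. For $\eta=(\eta_1,\eta_2)\in\mathbf Q$ let $A^2_{\eta,\mathrm{ext}}(\varpi)$ be the space of those $f\in A^2(\varpi)$ that extend analytically to an open set $U$ with $\overline\varpi\cap\Omega\subset U\subset\Omega$ in such a way that the extension satisfies $f(1+iy)=e^{i\eta_1}f(iy)$ for all $y\in(0,1)$ with $iy\in\Omega$, and $f(x+i)=e^{i\eta_2}f(x)$ for all $x\in(0,1)$ with $x\in\Omega$. Let $A^2_\eta(\varpi)$ be the closure of $A^2_{\eta,\mathrm{ext}}(\varpi)$ in $A^2(\varpi)$, and let $L^2(\mathbf Q;A^2_\eta(\varpi))$ be the subspace of the Bochner space $L^2(\mathbf Q;L^2(\varpi))$ of those $g$ with $g(\cdot,\eta)\in A^2_\eta(\varpi)$ for a.e. $\eta\in\mathbf Q$. Then the Floquet transform $$\mathsf Ff(z,\eta)=\frac1{2\pi}\sum_{m\in\Lambda}e^{-i\eta_1m_1-i\eta_2m_2}f(z+m),\qquad z\in\varpi,\ \eta\in\mathbf Q,$$ where the series converges unconditionally in $L^2(\mathbf Q;L^2(\varpi))$ for each $f\in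 A^2(\Omega)$, is a unitary operator from $A^2(\Omega)$ onto $L^2(\mathbf Q;A^2_\eta(\varpi))$. Its inverse is given, for $g\in L^2(\mathbf Q;A^2_\eta(\varpi))$, by $$\mathsf F^{-1}g(z)=\frac1{2\pi}\int_{\mathbf Q}e^{i[\operatorname{Re}z]\eta_1+i[\operatorname{Im}z]\eta_2}\,g\bigl(z-[\operatorname{Re}z]-i[\operatorname{Im}z],\eta\bigr)\,d\eta$$ for every $z\in\Omega$ with $z-[\operatorname{Re}z]-i[\operatorname{Im}z]\in\varpi$ (hence for a.e. $z\in\Omega$). Here $[x]$ is the largest integer not larger than $x$, the analytic representatives of $\mathsf F^{-1}g$ and of $g(\cdot,\eta)$ are used, and the integrand is absolutely integrable over $\mathbf Q$. -/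

import Mathlib

open MeasureTheory Complex Set
open scoped ENNReal

noncomputable section

namespace DoublyPeriodic

/-- The point `m₁ + i m₂` of the lattice `Λ = ℤ + iℤ` with index `m = (m₁, m₂)`. -/
def latticePt (m : ℤ × ℤ) : ℂ := (m.1 : ℂ) + (m.2 : ℂ) * I

/-- The open unit square `(0,1) × (0,1)`. -/
def unitSquare : Set ℂ := {z | z.re ∈ Ioo (0 : ℝ) 1 ∧ z.im ∈ Ioo (0 : ℝ) 1}

/-- The translate `ϖ + m` of a set. -/
def cellTranslate (ϖ : Set ℂ) (m : ℤ × ℤ) : Set ℂ := (fun z => z + latticePt m) '' ϖ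

/-- Periodic cells: domains inside the open unit square whose boundary contains the boundary of
the square and whose closure omits a nonempty open part of the square. -/
structure IsPeriodicCell (ϖ : Set ℂ) : Prop where
  isOpen : IsOpen ϖ
  isConnected : IsConnected ϖ
  subset_square : ϖ ⊆ unitSquare
  frontier_subset : frontier unitSquare ⊆ frontier ϖ
  exists_hole : ∃ V : Set ℂ, IsOpen V ∧ V.Nonempty ∧ V ⊆ unitSquare \ closure ϖ

/-- The doubly periodic domain generated by the cell `ϖ`: the interior of the union of the
closures of all its lattice translates. -/
def periodicDomain (ϖ : Set ℂ) : Set ℂ := interior (⋃ m : ℤ × ℤ, closure (cellTranslate ϖ m))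

/-- The poles of a meromorphic function. -/
def poles (f : ℂ → ℂ) : Set ℂ := {z | meromorphicOrderAt f z < 0}

/-- Condition `(𝒜)` on a doubly periodic domain `Ω`. Meromorphic functions on the plane are
represented by functions in normal form: analytic off the poles, and with value `0` at poles. -/
def ConditionA (Ω : Set ℂ) : Prop :=
  ∃ φ ϕ : ℂ → ℂ,
    -- `φ` is elliptic with periods `1` and `i`
    MeromorphicNFOn φ univ ∧ (∀ z, φ (z + 1) = φ z) ∧ (∀ z, φ (z + I) = φ z) ∧
    -- all zeros of `φ` are outside the closure of `Ω`
    (∀ z, 0 < meromorphicOrderAt φ z → z ∉ closure Ω) ∧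
    -- `ϕ` is meromorphic with finitely many poles, all of them in the open unit square
    MeromorphicNFOn ϕ univ ∧ (poles ϕ).Finite ∧ poles ϕ ⊆ unitSquare ∧
    -- `φ` is the sum of the lattice translates of `ϕ`
    (∀ z, (∀ m, z - latticePt m ∉ poles ϕ) →
      HasSum (fun m : ℤ × ℤ => ϕ (z - latticePt m)) (φ z)) ∧
    -- decay of `ϕ`
    ∃ b : ℝ, 2 < b ∧ ∃ d : ℝ, ∀ z ∈ Ω \ closure unitSquare, (1 + ‖z‖) ^ b * ‖ϕ z‖ ≤ d

/-- `L²(D)` with respect to the area measure. -/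
abbrev L2 (D : Set ℂ) : Type := Lp ℂ 2 (volume.restrict D : Measure ℂ)

/-- The Bergman space `A²(D)` of an open set `D`, as a subspace of `L²(D)`. -/
def bergmanSpace (D : Set ℂ) : Submodule ℂ (L2 D) where
  carrier := {f | ∃ G : ℂ → ℂ, DifferentiableOn ℂ G D ∧ f =ᵐ[volume.restrict D] G}
  zero_mem' := ⟨0, differentiableOn_const 0, Lp.coeFn_zero _ _ _⟩
  add_mem' := by
    rintro f g ⟨F, hF, hf⟩ ⟨G, hG, hg⟩
    exact ⟨F + G, hF.add hG, (Lp.coeFn_add f g).trans (hf.add hg)⟩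
  smul_mem' := by
    rintro c f ⟨F, hF, hf⟩
    exact ⟨c • F, hF.const_smul c, (Lp.coeFn_smul c f).trans (hf.const_smul c)⟩

open Classical in
/-- The analytic representative of an element of the Bergman space (and `0` for other elements of
`L²(D)`). For open `D` its values at the points of `D` are uniquely determined. -/
def analyticRep (D : Set ℂ) (f : L2 D) : ℂ → ℂ :=
  if h : f ∈ bergmanSpace D then h.choose else 0

/-- The space `A²_{η,ext}(ϖ)` of Bergman functions on the cell that extend analytically to a
neighbourhood (in `Ω`) of `closure ϖ ∩ Ω` and whose extension satisfies the `η`-quasiperiodic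
boundary conditions at the boundary points of the square that belong to `Ω`. -/
def bergmanExt (ϖ : Set ℂ) (η : ℝ × ℝ) : Submodule ℂ (L2 ϖ) where
  carrier := {f | f ∈ bergmanSpace ϖ ∧ ∃ (U : Set ℂ) (G : ℂ → ℂ),
    IsOpen U ∧ closure ϖ ∩ periodicDomain ϖ ⊆ U ∧ U ⊆ periodicDomain ϖ ∧
    DifferentiableOn ℂ G U ∧ f =ᵐ[volume.restrict ϖ] G ∧
    (∀ y ∈ Ioo (0 : ℝ) 1, (y : ℂ) * I ∈ periodicDomain ϖ →
      G (1 + (y : ℂ) * I) = exp ((η.1 : ℂ) * I) * G ((y : ℂ) * I)) ∧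
    (∀ x ∈ Ioo (0 : ℝ) 1, (x : ℂ) ∈ periodicDomain ϖ →
      G ((x : ℂ) + I) = exp ((η.2 : ℂ) * I) * G (x : ℂ))}
  zero_mem' := ⟨zero_mem _, periodicDomain ϖ, 0, isOpen_interior, inter_subset_right,
    subset_rfl, differentiableOn_const 0, Lp.coeFn_zero _ _ _, by simp, by simp⟩
  add_mem' := by
    rintro f g ⟨hf0, U, F, hU, hU1, hU2, hF, hf, h1, h2⟩ ⟨hg0, V, G, hV, hV1, hV2, hG, hg, k1, k2⟩
    refine ⟨add_mem hf0 hg0, U ∩ V, F + G, hU.inter hV, subset_inter hU1 hV1,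
      inter_subset_left.trans hU2, (hF.mono inter_subset_left).add (hG.mono inter_subset_right),
      (Lp.coeFn_add f g).trans (hf.add hg), fun y hy hy' => ?_, fun x hx hx' => ?_⟩
    · simp only [Pi.add_apply, h1 y hy hy', k1 y hy hy', mul_add]
    · simp only [Pi.add_apply, h2 x hx hx', k2 x hx hx', mul_add]
  smul_mem' := by
    rintro c f ⟨hf0, U, F, hU, hU1, hU2, hF, hf, h1, h2⟩
    refine ⟨Submodule.smul_mem _ c hf0, U, c • F, hU, hU1, hU2, hF.const_smul c,
      (Lp.coeFn_smul c f).trans (hf.const_smul c), fun y hy hy' => ?_, fun x hx hx' => ?_⟩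
    · simp only [Pi.smul_apply, h1 y hy hy', smul_eq_mul]; ring
    · simp only [Pi.smul_apply, h2 x hx hx', smul_eq_mul]; ring

/-- The space `A²_η(ϖ)`: the closure of `A²_{η,ext}(ϖ)` in `A²(ϖ)`. -/
def bergmanEta (ϖ : Set ℂ) (η : ℝ × ℝ) : Submodule ℂ (L2 ϖ) :=
  (bergmanExt ϖ η).topologicalClosure ⊓ bergmanSpace ϖ

/-- The square `[-π,π]²` of Floquet parameters. -/
def floquetBox : Set (ℝ × ℝ) := Icc (-Real.pi) Real.pi ×ˢ Icc (-Real.pi) Real.pi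

/-- The Bochner space `L²([-π,π]²; L²(ϖ))`. -/
abbrev BochnerL2 (ϖ : Set ℂ) : Type := Lp (L2 ϖ) 2 (volume.restrict floquetBox)

/-- The subspace `L²([-π,π]²; A²_η(ϖ))` of those `g` in `L²([-π,π]²; L²(ϖ))` for which
`g(·, η)` belongs to `A²_η(ϖ)` for almost every `η`. -/
def bochnerBergman (ϖ : Set ℂ) : Submodule ℂ (BochnerL2 ϖ) where
  carrier := {g | ∀ᵐ η ∂(volume.restrict floquetBox), g η ∈ bergmanEta ϖ η}
  zero_mem' := by
    filter_upwards [Lp.coeFn_zero (L2 ϖ) 2 (volume.restrict floquetBox)] with η h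
    rw [h]; exact zero_mem _
  add_mem' := by
    intro f g hf hg
    filter_upwards [hf, hg, Lp.coeFn_add f g] with η h1 h2 h
    rw [h]; exact add_mem h1 h2
  smul_mem' := by
    intro c f hf
    filter_upwards [hf, Lp.coeFn_smul c f] with η h1 h
    rw [h]; exact Submodule.smul_mem _ c h1

/-- The phase `η₁ m₁ + η₂ m₂`. -/
def phase (η : ℝ × ℝ) (m : ℤ × ℤ) : ℝ := η.1 * m.1 + η.2 * m.2

lemma IsPeriodicCell.translate_subset {ϖ : Set ℂ} (h : IsPeriodicCell ϖ) (m : ℤ × ℤ) :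
    cellTranslate ϖ m ⊆ periodicDomain ϖ := by
  refine interior_maximal ?_ ((isOpenMap_add_right (latticePt m)) ϖ h.isOpen)
  exact subset_closure.trans (subset_iUnion (fun k => closure (cellTranslate ϖ k)) m)

lemma IsPeriodicCell.memLp_shift {ϖ : Set ℂ} (h : IsPeriodicCell ϖ) (m : ℤ × ℤ)
    (f : L2 (periodicDomain ϖ)) :
    MemLp (fun z => f (z + latticePt m)) 2 (volume.restrict ϖ) := by
  have hmp : MeasurePreserving (fun z : ℂ => z + latticePt m) (volume.restrict ϖ)
      (volume.restrict (cellTranslate ϖ m)) :=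
    (measurePreserving_add_right volume (latticePt m)).restrict_image_emb
      (measurableEmbedding_addRight (latticePt m)) ϖ
  exact ((Lp.memLp f).mono_measure
    (Measure.restrict_mono (h.translate_subset m) le_rfl)).comp_measurePreserving hmp

/-- The element `z ↦ f(z + m)` of `L²(ϖ)`, for `f` in `L²(Ω)`. -/
def shift {ϖ : Set ℂ} (h : IsPeriodicCell ϖ) (m : ℤ × ℤ) (f : L2 (periodicDomain ϖ)) : L2 ϖ :=
  (h.memLp_shift m f).toLp _

lemma memLp_term {ϖ : Set ℂ} (m : ℤ × ℤ) (v : L2 ϖ) :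
    MemLp (fun η : ℝ × ℝ => ((1 / (2 * Real.pi) : ℂ) * exp (-(phase η m : ℂ) * I)) • v) 2
      (volume.restrict floquetBox) := by
  have hfin : IsFiniteMeasure (volume.restrict floquetBox : Measure (ℝ × ℝ)) :=
    ⟨by
      rw [Measure.restrict_apply_univ]
      exact ((isCompact_Icc (a := -Real.pi) (b := Real.pi)).prod
        (isCompact_Icc (a := -Real.pi) (b := Real.pi))).measure_lt_top⟩
  have hc : Continuous
      (fun η : ℝ × ℝ => ((1 / (2 * Real.pi) : ℂ) * exp (-(phase η m : ℂ) * I)) • v) := by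
    unfold phase; fun_prop
  refine MemLp.of_bound hc.aestronglyMeasurable (‖(1 / (2 * Real.pi) : ℂ)‖ * ‖v‖)
    (Filter.Eventually.of_forall fun η => ?_)
  rw [norm_smul, norm_mul, ← ofReal_neg, norm_exp_ofReal_mul_I, mul_one]

/-- The `m`-th term `(2π)⁻¹ e^{-i η₁ m₁ - i η₂ m₂} f(z + m)` of the Floquet series of `f`, as an
element of `L²([-π,π]²; L²(ϖ))`. -/
def floquetTerm {ϖ : Set ℂ} (h : IsPeriodicCell ϖ) (f : L2 (periodicDomain ϖ)) (m : ℤ × ℤ) :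
    BochnerL2 ϖ :=
  (memLp_term m (shift h m f)).toLp _

/-- The index `([Re z], [Im z])`. -/
def floorIdx (z : ℂ) : ℤ × ℤ := (⌊z.re⌋, ⌊z.im⌋)

end DoublyPeriodic

end

open DoublyPeriodic

/-! The terms of the Floquet series of `f` are pairwise orthogonal and the squares of their norms
add up to `‖f‖²`, so the transform is an isometry. The series converges also over a neighbourhood
in `Ω` of the closed cell, where its value at `η` is analytic and `η`-quasiperiodic.

For surjectivity, an element `v` of `A²_{η,ext}(ϖ)` extends `η`-quasiperiodically to `Ω`. The hole
of the cell contains a point `a`. The lattice sums of `(z - a)⁻³` and `(z - a)⁻⁴` are, up to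
constants, `℘'(z - a)` and `℘''(z - a)`, and for the square lattice these generate the unit ideal
of `ℂ[℘, ℘']`; so some combination of `(z - a)⁻³` and `(z - a)⁻⁴` with such elliptic coefficients
is analytic on `Ω` and has absolutely summable translates adding up to `1`. Multiplying the
extension by it gives `f ∈ A²(Ω)` whose Floquet series is continuous in the parameter and has the
value `v / 2π` at `η`. The range of the transform is invariant under multiplication by the
characters of the parameter, so by the uniqueness of Fourier coefficients an element orthogonal
to the range is, for almost every parameter, orthogonal to all such values.

The inversion formula is Fourier inversion for the point evaluations of analytic functions, which
are bounded functionals because they are averages over discs.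
-/

namespace DoublyPeriodic

section Translation

lemma measurePreserving_add_right_restrict {G : Type*} [MeasurableSpace G] [AddGroup G]
    [MeasurableAdd G] (μ : Measure G) [μ.IsAddRightInvariant] (s : Set G) (k : G) :
    MeasurePreserving (fun z => z + k) (μ.restrict s) (μ.restrict ((fun z => z + k) '' s)) :=
  (measurePreserving_add_right μ k).restrict_image_emb (measurableEmbedding_addRight k) s

section General

variable {G E : Type*} [MeasurableSpace G] [AddGroup G] [MeasurableAdd G] {μ : Measure G}
  [μ.IsAddRightInvariant] [NormedAddCommGroup E] {s t : Set G} {k : G} {f : G → E} {p : ℝ≥0∞}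

lemma quasiMeasurePreserving_translate (h : MapsTo (fun z => z + k) t s) :
    Measure.QuasiMeasurePreserving (fun z => z + k) (μ.restrict t) (μ.restrict s) :=
  (measurePreserving_add_right_restrict μ t k).quasiMeasurePreserving.mono_right
    (Measure.restrict_mono h.image_subset le_rfl).absolutelyContinuous

lemma eLpNorm_translate_le (h : MapsTo (fun z => z + k) t s)
    (hf : AEStronglyMeasurable f (μ.restrict s)) :
    eLpNorm (fun z => f (z + k)) p (μ.restrict t) ≤ eLpNorm f p (μ.restrict s) := by
  have hle : μ.restrict ((fun z => z + k) '' t) ≤ μ.restrict s :=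
    Measure.restrict_mono h.image_subset le_rfl
  exact (eLpNorm_comp_measurePreserving (hf.mono_measure hle)
    (measurePreserving_add_right_restrict μ t k)).trans_le (eLpNorm_mono_measure f hle)

lemma memLp_translate (h : MapsTo (fun z => z + k) t s) (hf : MemLp f p (μ.restrict s)) :
    MemLp (fun z => f (z + k)) p (μ.restrict t) :=
  ⟨hf.1.comp_quasiMeasurePreserving (quasiMeasurePreserving_translate h),
    (eLpNorm_translate_le h hf.1).trans_lt hf.2⟩

end General

variable {D D' D'' : Set ℂ} {k l : ℂ}

/-- Translation `f ↦ f(· + k)` from `L²(D)` to `L²(D')`, for `D' + k ⊆ D`. -/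
noncomputable def translateL (k : ℂ) (h : MapsTo (fun z => z + k) D' D) : L2 D →L[ℂ] L2 D' :=
  LinearMap.mkContinuous
    { toFun := fun f => (memLp_translate h (Lp.memLp f)).toLp _
      map_add' := fun f g => by
        rw [← MemLp.toLp_add]
        exact MemLp.toLp_congr _ _
          ((quasiMeasurePreserving_translate h).ae_eq_comp (Lp.coeFn_add f g))
      map_smul' := fun c f => by
        rw [RingHom.id_apply, ← MemLp.toLp_const_smul]
        exact MemLp.toLp_congr _ _
          ((quasiMeasurePreserving_translate h).ae_eq_comp (Lp.coeFn_smul c f)) }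
    1 (fun f => by
      rw [one_mul, LinearMap.coe_mk, AddHom.coe_mk, Lp.norm_toLp, Lp.norm_def]
      exact ENNReal.toReal_mono (Lp.memLp f).2.ne (eLpNorm_translate_le h (Lp.memLp f).1))

lemma coeFn_translateL (h : MapsTo (fun z => z + k) D' D) (f : L2 D) :
    translateL k h f =ᵐ[volume.restrict D'] fun z => f (z + k) :=
  (memLp_translate h (Lp.memLp f)).coeFn_toLp

lemma translateL_congr (h : MapsTo (fun z => z + k) D' D) {f : L2 D} {F : ℂ → ℂ}
    (hf : f =ᵐ[volume.restrict D] F) :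
    translateL k h f =ᵐ[volume.restrict D'] fun z => F (z + k) :=
  (coeFn_translateL h f).trans ((quasiMeasurePreserving_translate h).ae_eq_comp hf)

lemma translateL_translateL (h : MapsTo (fun z => z + k) D' D)
    (h' : MapsTo (fun z => z + l) D'' D') (h'' : MapsTo (fun z => z + (l + k)) D'' D) (f : L2 D) :
    translateL l h' (translateL k h f) = translateL (l + k) h'' f := by
  refine Lp.ext ((translateL_congr h' (coeFn_translateL h f)).trans ?_)
  refine Filter.EventuallyEq.trans ?_ (coeFn_translateL h'' f).symm
  exact .of_forall fun _ => by simp only [add_assoc]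

lemma translateL_mem_bergmanSpace (h : MapsTo (fun z => z + k) D' D) {f : L2 D}
    (hf : f ∈ bergmanSpace D) : translateL k h f ∈ bergmanSpace D' := by
  obtain ⟨F, hF, hfF⟩ := hf
  exact ⟨fun z => F (z + k), hF.comp (by fun_prop) h, translateL_congr h hfF⟩

end Translation

section Lattice

@[simp] lemma latticePt_zero : latticePt 0 = 0 := by simp [latticePt]

lemma latticePt_add (m n : ℤ × ℤ) : latticePt (m + n) = latticePt m + latticePt n := by
  simp only [latticePt, Prod.fst_add, Prod.snd_add]; push_cast; ring

lemma latticePt_neg (m : ℤ × ℤ) : latticePt (-m) = -latticePt m := by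
  simp only [latticePt, Prod.fst_neg, Prod.snd_neg]; push_cast; ring

@[simp] lemma latticePt_re (m : ℤ × ℤ) : (latticePt m).re = m.1 := by simp [latticePt]

@[simp] lemma latticePt_im (m : ℤ × ℤ) : (latticePt m).im = m.2 := by simp [latticePt]

lemma floorIdx_add (z : ℂ) (m : ℤ × ℤ) : floorIdx (z + latticePt m) = floorIdx z + m := by
  ext <;> simp [floorIdx]

lemma floorIdx_of_mem_unitSquare {z : ℂ} (hz : z ∈ unitSquare) : floorIdx z = 0 := by
  obtain ⟨⟨hre, hre'⟩, him, him'⟩ := hz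
  ext <;> simp only [floorIdx, Prod.fst_zero, Prod.snd_zero, Int.floor_eq_zero_iff]
  · exact ⟨hre.le, hre'⟩
  · exact ⟨him.le, him'⟩

lemma floorIdx_add_of_mem_unitSquare {z : ℂ} (hz : z ∈ unitSquare) (m : ℤ × ℤ) :
    floorIdx (z + latticePt m) = m := by
  rw [floorIdx_add, floorIdx_of_mem_unitSquare hz, zero_add]

lemma isOpen_unitSquare : IsOpen unitSquare := isOpen_Ioo.reProdIm isOpen_Ioo

lemma closure_unitSquare : closure unitSquare = Icc (0 : ℝ) 1 ×ℂ Icc (0 : ℝ) 1 := by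
  change closure (Ioo (0 : ℝ) 1 ×ℂ Ioo (0 : ℝ) 1) = _
  rw [closure_reProdIm, closure_Ioo zero_ne_one]

lemma isCompact_closure_unitSquare : IsCompact (closure unitSquare) := by
  rw [closure_unitSquare]; exact isCompact_Icc.reProdIm isCompact_Icc

lemma mem_closure_unitSquare {z : ℂ} :
    z ∈ closure unitSquare ↔ z.re ∈ Icc (0 : ℝ) 1 ∧ z.im ∈ Icc (0 : ℝ) 1 := by
  rw [closure_unitSquare]; exact mem_reProdIm

lemma eq_zero_of_add_latticePt_mem_closure_unitSquare {z : ℂ} (hz : z ∈ unitSquare) {m : ℤ × ℤ}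
    (hm : z + latticePt m ∈ closure unitSquare) : m = 0 := by
  rw [mem_closure_unitSquare] at hm
  simp only [add_re, add_im, latticePt_re, latticePt_im, mem_Icc] at hm
  obtain ⟨⟨hre, hre'⟩, him, him'⟩ := hz
  obtain ⟨⟨kre, kre'⟩, kim, kim'⟩ := hm
  have lower₁ : (-1 : ℝ) < m.1 := by linarith
  have upper₁ : (m.1 : ℝ) < 1 := by linarith
  have lower₂ : (-1 : ℝ) < m.2 := by linarith
  have upper₂ : (m.2 : ℝ) < 1 := by linarith
  norm_cast at lower₁ upper₁ lower₂ upper₂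
  exact Prod.ext (by simp; lia) (by simp; lia)

end Lattice

section PeriodicDomain

variable {ϖ : Set ℂ} {z : ℂ} {m : ℤ × ℤ}

lemma mem_cellTranslate : z ∈ cellTranslate ϖ m ↔ z - latticePt m ∈ ϖ :=
  ⟨by rintro ⟨w, hw, rfl⟩; simpa using hw, fun h => ⟨_, h, by simp⟩⟩

lemma closure_cellTranslate (ϖ : Set ℂ) (m : ℤ × ℤ) :
    closure (cellTranslate ϖ m) = cellTranslate (closure ϖ) m :=
  ((Homeomorph.addRight (latticePt m)).image_closure ϖ).symm

lemma isOpen_periodicDomain (ϖ : Set ℂ) : IsOpen (periodicDomain ϖ) := isOpen_interior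

lemma add_mem_periodicDomain (m : ℤ × ℤ) (hz : z ∈ periodicDomain ϖ) :
    z + latticePt m ∈ periodicDomain ϖ := by
  have himage : (fun w => w + latticePt m) '' periodicDomain ϖ ⊆ periodicDomain ϖ := by
    refine interior_maximal ?_ (isOpenMap_add_right (latticePt m) _ isOpen_interior)
    rintro _ ⟨w, hw, rfl⟩
    obtain ⟨k, hk⟩ := mem_iUnion.1 (interior_subset hw)
    refine mem_iUnion.2 ⟨k + m, ?_⟩
    rw [closure_cellTranslate, mem_cellTranslate] at hk ⊢
    simpa [latticePt_add] using hk
  exact himage (mem_image_of_mem _ hz)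

lemma sub_mem_periodicDomain (m : ℤ × ℤ) (hz : z ∈ periodicDomain ϖ) :
    z - latticePt m ∈ periodicDomain ϖ := by
  simpa [latticePt_neg, sub_eq_add_neg] using add_mem_periodicDomain (-m) hz

namespace IsPeriodicCell

lemma mapsTo_add_latticePt (h : IsPeriodicCell ϖ) (m : ℤ × ℤ) :
    MapsTo (fun z => z + latticePt m) ϖ (periodicDomain ϖ) :=
  fun _ hz => h.translate_subset m (mem_image_of_mem _ hz)

lemma subset_periodicDomain (h : IsPeriodicCell ϖ) : ϖ ⊆ periodicDomain ϖ := fun z hz => by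
  simpa using h.mapsTo_add_latticePt 0 hz

lemma pairwise_disjoint_cellTranslate (h : IsPeriodicCell ϖ) :
    Pairwise (Function.onFun Disjoint (cellTranslate ϖ)) := by
  have hfloor : ∀ z k, z ∈ cellTranslate ϖ k → floorIdx z = k := by
    rintro z k ⟨w, hw, rfl⟩
    exact floorIdx_add_of_mem_unitSquare (h.subset_square hw) k
  exact fun m n hmn => disjoint_left.2 fun z hm hn => hmn <|
    (hfloor z m hm).symm.trans (hfloor z n hn)

lemma mem_closure (h : IsPeriodicCell ϖ) (hz : z ∈ periodicDomain ϖ)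
    (hz' : z ∈ closure unitSquare) : z ∈ closure ϖ := by
  by_cases hS : z ∈ unitSquare
  · obtain ⟨m, hm⟩ := mem_iUnion.1 (interior_subset hz)
    rw [closure_cellTranslate, mem_cellTranslate] at hm
    have hm0 : -m = 0 := eq_zero_of_add_latticePt_mem_closure_unitSquare hS <| by
      rw [latticePt_neg, ← sub_eq_add_neg]
      exact closure_mono h.subset_square hm
    simpa [neg_eq_zero.1 hm0] using hm
  · refine frontier_subset_closure (h.frontier_subset ?_)
    rw [frontier, isOpen_unitSquare.interior_eq]
    exact ⟨hz', hS⟩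

lemma lintegral_periodicDomain (h : IsPeriodicCell ϖ)
    (hnull : volume (periodicDomain ϖ \ ⋃ m : ℤ × ℤ, cellTranslate ϖ m) = 0) (u : ℂ → ℝ≥0∞) :
    ∫⁻ z in periodicDomain ϖ, u z = ∑' m : ℤ × ℤ, ∫⁻ z in ϖ, u (z + latticePt m) := by
  have hae : (periodicDomain ϖ : Set ℂ) =ᵐ[volume] ⋃ m : ℤ × ℤ, cellTranslate ϖ m :=
    (ae_le_set.2 hnull).antisymm (iUnion_subset h.translate_subset).eventuallyLE
  have hmeas : ∀ m : ℤ × ℤ, MeasurableSet (cellTranslate ϖ m) := fun m =>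
    ((isOpenMap_add_right (latticePt m)) ϖ h.isOpen).measurableSet
  rw [Measure.restrict_congr_set hae, lintegral_iUnion hmeas h.pairwise_disjoint_cellTranslate]
  exact tsum_congr fun m => ((measurePreserving_add_right_restrict volume ϖ
    (latticePt m)).lintegral_comp_emb (measurableEmbedding_addRight (latticePt m)) u).symm

lemma shift_eq_translateL (h : IsPeriodicCell ϖ) (m : ℤ × ℤ) (f : L2 (periodicDomain ϖ)) :
    shift h m f = translateL (latticePt m) (h.mapsTo_add_latticePt m) f := rfl

end IsPeriodicCell

end PeriodicDomain

section Weierstrass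

variable (L : PeriodPair)

lemma isPreconnected_compl_lattice : IsPreconnected (L.lattice : Set ℂ)ᶜ := by
  have hcount : (L.lattice : Set ℂ).Countable :=
    L.latticeEquivProd.toEquiv.countable_iff.2 inferInstance
  exact (hcount.isPathConnected_compl_of_one_lt_rank
    (rank_real_complex ▸ Nat.one_lt_ofNat)).isConnected.isPreconnected

lemma derivWeierstrassP_eq_sumInvPow {z : ℂ} (hz : z ∉ L.lattice) :
    L.derivWeierstrassP z = 2 * L.sumInvPow z 3 := by
  simpa [L.derivWeierstrassPExcept_of_notMem z hz] using
    L.iteratedDeriv_derivWeierstrassPExcept_self z (n := 0)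

lemma deriv_derivWeierstrassP_eq_sumInvPow {z : ℂ} (hz : z ∉ L.lattice) :
    deriv L.derivWeierstrassP z = 6 * L.sumInvPow z 4 := by
  simpa [L.derivWeierstrassPExcept_of_notMem z hz, Nat.factorial] using
    L.iteratedDeriv_derivWeierstrassPExcept_self z (n := 1)

lemma not_eqOn_const_weierstrassP (c : ℂ) :
    ¬ EqOn L.weierstrassP (fun _ => c) (L.lattice : Set ℂ)ᶜ := by
  intro hc
  have hpole := L.order_weierstrassP 0 L.lattice.zero_mem
  have hnear : L.weierstrassP =ᶠ[nhdsWithin 0 {0}ᶜ] fun _ => c := by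
    filter_upwards [self_mem_nhdsWithin,
      mem_nhdsWithin_of_mem_nhds (L.compl_lattice_sdiff_singleton_mem_nhds 0)] with z hz hz'
    exact hc fun hzL => hz' ⟨hzL, hz⟩
  rw [meromorphicOrderAt_congr hnear, meromorphicOrderAt_const] at hpole
  split_ifs at hpole <;> exact absurd hpole (by decide)

lemma deriv_derivWeierstrassP {z : ℂ} (hz : z ∉ L.lattice) :
    deriv L.derivWeierstrassP z = 6 * L.weierstrassP z ^ 2 - L.g₂ / 2 := by
  have hopen : IsOpen (L.lattice : Set ℂ)ᶜ := L.isClosed_lattice.isOpen_compl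
  have hP := L.analyticOnNhd_weierstrassP
  have hP' := L.analyticOnNhd_derivWeierstrassP
  have hmul : ∀ w ∈ (L.lattice : Set ℂ)ᶜ, L.derivWeierstrassP w *
      (deriv L.derivWeierstrassP w - (6 * L.weierstrassP w ^ 2 - L.g₂ / 2)) = 0 := by
    intro w hw
    have hdP : HasDerivAt L.weierstrassP (L.derivWeierstrassP w) w := by
      simpa using (hP w hw).differentiableAt.hasDerivAt
    have hdP' := (hP' w hw).differentiableAt.hasDerivAt
    have heq : (fun w => L.derivWeierstrassP w ^ 2) =ᶠ[nhds w]
        fun w => 4 * L.weierstrassP w ^ 3 - L.g₂ * L.weierstrassP w - L.g₃ := by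
      filter_upwards [hopen.mem_nhds hw] with v hv using L.derivWeierstrassP_sq v hv
    have hderiv := (hdP'.pow 2).unique
      (((((hdP.pow 3).const_mul 4).sub (hdP.const_mul L.g₂)).sub_const L.g₃).congr_of_eventuallyEq
        heq)
    linear_combination (1 / 2 : ℂ) * hderiv
  rcases AnalyticOnNhd.eq_zero_or_eq_zero_of_mul_eq_zero hP'
    (hP'.deriv.sub ((analyticOnNhd_const.mul (hP.pow 2)).sub analyticOnNhd_const)) hmul
    (isPreconnected_compl_lattice L) with hzero | hode
  · refine absurd (fun w hw => ?_) (not_eqOn_const_weierstrassP L (L.weierstrassP z))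
    exact hopen.is_const_of_deriv_eq_zero (isPreconnected_compl_lattice L)
      L.differentiableOn_weierstrassP (by simpa [EqOn] using hzero) hw hz
  · exact sub_eq_zero.1 (hode z hz)

lemma derivWeierstrassP_half_period : L.derivWeierstrassP (L.ω₁ / 2) = 0 := by
  have hper := L.derivWeierstrassP_sub_coe (L.ω₁ / 2) ⟨L.ω₁, L.ω₁_mem_lattice⟩
  rw [show L.ω₁ / 2 - L.ω₁ = -(L.ω₁ / 2) by ring, L.derivWeierstrassP_neg] at hper
  exact self_eq_neg.1 hper.symm

/-- At a half period `℘'` vanishes; if `℘'² = 4℘³`, then so does `℘`, and the orders of vanishing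
`n - 1` of `℘'` and `n` of `℘` satisfy `2(n - 1) = 3n`. -/
lemma g₂_ne_zero_or_g₃_ne_zero : L.g₂ ≠ 0 ∨ L.g₃ ≠ 0 := by
  by_contra! hg
  have hz := L.ω₁_div_two_notMem_lattice
  have hP : AnalyticAt ℂ L.weierstrassP (L.ω₁ / 2) := L.analyticOnNhd_weierstrassP _ hz
  have hP' : AnalyticAt ℂ L.derivWeierstrassP (L.ω₁ / 2) := L.analyticOnNhd_derivWeierstrassP _ hz
  have hsq : ∀ w ∈ (L.lattice : Set ℂ)ᶜ, L.derivWeierstrassP w ^ 2 = 4 * L.weierstrassP w ^ 3 :=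
    fun w hw => by simpa [hg.1, hg.2] using L.derivWeierstrassP_sq w hw
  have hroot : L.weierstrassP (L.ω₁ / 2) = 0 := by
    simpa [derivWeierstrassP_half_period] using hsq _ hz
  have horder : analyticOrderAt L.derivWeierstrassP (L.ω₁ / 2) + 1 =
      analyticOrderAt L.weierstrassP (L.ω₁ / 2) := by
    simpa [hroot] using hP.analyticOrderAt_deriv_add_one
  have hfinite : analyticOrderAt L.weierstrassP (L.ω₁ / 2) ≠ ⊤ := fun htop =>
    not_eqOn_const_weierstrassP L 0
      (L.analyticOnNhd_weierstrassP.eqOn_zero_of_preconnected_of_eventuallyEq_zero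
        (isPreconnected_compl_lattice L) hz (analyticOrderAt_eq_top.1 htop))
  have hpow : 2 * analyticOrderAt L.derivWeierstrassP (L.ω₁ / 2) =
      3 * analyticOrderAt L.weierstrassP (L.ω₁ / 2) := by
    have hcongr : L.derivWeierstrassP ^ 2 =ᶠ[nhds (L.ω₁ / 2)]
        (fun _ => (4 : ℂ)) * L.weierstrassP ^ 3 := by
      filter_upwards [L.isClosed_lattice.isOpen_compl.mem_nhds hz] with w hw
      simpa using hsq w hw
    have hfour : analyticOrderAt (fun _ => (4 : ℂ)) (L.ω₁ / 2) = 0 :=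
      analyticAt_const.analyticOrderAt_eq_zero.2 (by norm_num)
    simpa [analyticOrderAt_pow hP', analyticOrderAt_mul analyticAt_const (hP.pow 3),
      analyticOrderAt_pow hP, hfour] using analyticOrderAt_congr hcongr
  generalize analyticOrderAt L.weierstrassP (L.ω₁ / 2) = n at *
  generalize analyticOrderAt L.derivWeierstrassP (L.ω₁ / 2) = k at *
  lift n to ℕ using hfinite
  lift k to ℕ using fun htop => by simp [htop] at horder
  norm_cast at horder hpow
  omega

end Weierstrass

section SquareLattice

/-- The lattice `Λ = ℤ + iℤ` as a pair of periods. -/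
noncomputable def squareLattice : PeriodPair where
  ω₁ := 1
  ω₂ := I
  indep := by simpa only [coe_basisOneI] using basisOneI.linearIndependent

lemma latticePt_eq_squareLattice_symm (m : ℤ × ℤ) :
    latticePt m = squareLattice.latticeEquivProd.symm m := by
  rw [PeriodPair.latticeEquiv_symm_apply]
  simp [latticePt, squareLattice]

lemma latticePt_mem_squareLattice (m : ℤ × ℤ) : latticePt m ∈ squareLattice.lattice := by
  simp [latticePt_eq_squareLattice_symm]

lemma mem_squareLattice {w : ℂ} : w ∈ squareLattice.lattice ↔ ∃ m, latticePt m = w :=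
  ⟨fun hw => ⟨squareLattice.latticeEquivProd ⟨w, hw⟩, by simp [latticePt_eq_squareLattice_symm]⟩,
    by rintro ⟨m, rfl⟩; exact latticePt_mem_squareLattice m⟩

/-- Multiplication by `i` permutes the square lattice, and `i⁶ = -1`. -/
lemma g₃_squareLattice : squareLattice.g₃ = 0 := by
  let rot : ℤ × ℤ ≃ ℤ × ℤ := (Equiv.prodComm ℤ ℤ).trans ((Equiv.neg ℤ).prodCongr (Equiv.refl ℤ))
  have hrot : ∀ m, latticePt (rot m) = I * latticePt m := fun m => by
    simp only [rot, latticePt, Equiv.trans_apply, Equiv.prodComm_apply, Equiv.prodCongr_apply,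
      Prod.map, Prod.fst_swap, Prod.snd_swap, Equiv.neg_apply, Equiv.refl_apply, Int.cast_neg]
    linear_combination (-(m.2 : ℂ)) * I_sq
  have hG : squareLattice.G 6 = ∑' m, (latticePt m ^ 6)⁻¹ := by
    simp_rw [latticePt_eq_squareLattice_symm]
    exact (squareLattice.latticeEquivProd.symm.toEquiv.tsum_eq fun l => ((l : ℂ) ^ 6)⁻¹).symm
  have hneg : squareLattice.G 6 = -squareLattice.G 6 := by
    have hI : I ^ 6 = -1 := by linear_combination (I ^ 4 - I ^ 2 + 1) * I_sq
    calc squareLattice.G 6 = ∑' m, (latticePt (rot m) ^ 6)⁻¹ := by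
          rw [hG, rot.tsum_eq fun m => (latticePt m ^ 6)⁻¹]
      _ = -squareLattice.G 6 := by
        simp only [hrot, mul_pow, hI, neg_mul, one_mul, inv_neg, tsum_neg, hG]
  rw [PeriodPair.g₃, self_eq_neg.1 hneg, mul_zero]

lemma g₂_squareLattice_ne_zero : squareLattice.g₂ ≠ 0 :=
  (g₂_ne_zero_or_g₃_ne_zero squareLattice).resolve_right (not_not.2 g₃_squareLattice)

lemma hasSum_inv_add_latticePt_pow (w : ℂ) {r : ℕ} (hr : 2 < r) :
    HasSum (fun m => ((w + latticePt m) ^ r)⁻¹) ((-1) ^ r * squareLattice.sumInvPow w r) := by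
  have hsum := ((((Equiv.neg _).trans squareLattice.latticeEquivProd.symm.toEquiv).hasSum_iff).2
    (squareLattice.hasSum_sumInvPow w hr)).mul_left ((-1) ^ r)
  refine hsum.congr_fun fun m => ?_
  have hneg : ((squareLattice.latticeEquivProd.symm (-m) : squareLattice.lattice) : ℂ) - w =
      -1 * (w + latticePt m) := by
    rw [← latticePt_eq_squareLattice_symm, latticePt_neg]; ring
  have hone : ((-1 : ℂ) ^ r) * ((-1) ^ r)⁻¹ = 1 := mul_inv_cancel₀ (pow_ne_zero _ (by norm_num))
  calc ((w + latticePt m) ^ r)⁻¹ = (-1) ^ r * ((-1 * (w + latticePt m)) ^ r)⁻¹ := by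
        rw [mul_pow, mul_inv, ← mul_assoc, hone, one_mul]
    _ = _ := by rw [← hneg]; rfl

end SquareLattice

section Partition

lemma summable_inv_one_add_norm_pow {r : ℕ} (hr : 2 < r) :
    Summable fun m : ℤ × ℤ => ((1 + ‖m‖) ^ r)⁻¹ := by
  have hsum : Summable fun m : ℤ × ℤ => (‖m‖ ^ r)⁻¹ := by
    rw [← (finTwoArrowEquiv ℤ).summable_iff]
    refine (EisensteinSeries.summable_one_div_norm_rpow (k := r) (by exact_mod_cast hr)).congr
      fun x => ?_
    rw [Real.rpow_neg (norm_nonneg x), Real.rpow_natCast]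
    simp [Pi.norm_def, Prod.norm_def, Finset.univ_fin2]
  refine Summable.of_norm_bounded_eventually hsum ?_
  filter_upwards [Filter.eventually_cofinite_ne 0] with m hm
  have : 0 < ‖m‖ := norm_pos_iff.2 hm
  rw [Real.norm_of_nonneg (by positivity)]
  gcongr
  linarith

lemma norm_le_norm_latticePt (m : ℤ × ℤ) : ‖m‖ ≤ ‖latticePt m‖ := by
  rw [Prod.norm_def, sup_le_iff, Int.norm_eq_abs, Int.norm_eq_abs]
  exact ⟨by simpa using abs_re_le_norm (latticePt m), by simpa using abs_im_le_norm (latticePt m)⟩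

variable {K : Set ℂ}

lemma exists_one_add_norm_le_mul_norm_add_latticePt (hK : IsCompact K)
    (hd : Disjoint K squareLattice.lattice) :
    ∃ C : ℝ, 0 < C ∧ ∀ m, ∀ w ∈ K, 1 + ‖m‖ ≤ C * ‖w + latticePt m‖ := by
  obtain ⟨R, hR⟩ := hK.isBounded.exists_norm_le
  obtain ⟨δ, hδ, hsep⟩ :=
    Metric.exists_pos_forall_lt_edist hK squareLattice.isClosed_lattice hd
  refine ⟨1 + (1 + |R|) / δ, by positivity, fun m w hw => ?_⟩
  have hfar : δ ≤ ‖w + latticePt m‖ := by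
    have hlt := hsep w hw _ (latticePt_mem_squareLattice (-m))
    rw [latticePt_neg, edist_dist, dist_eq_norm, sub_neg_eq_add, ← ENNReal.ofReal_coe_nnreal] at hlt
    exact (ENNReal.ofReal_lt_ofReal_iff_of_nonneg δ.coe_nonneg).1 hlt |>.le
  calc 1 + ‖m‖ ≤ 1 + (‖w + latticePt m‖ + |R|) := by
        gcongr
        refine (norm_le_norm_latticePt m).trans ?_
        rw [← add_sub_cancel_left w (latticePt m)]
        refine (norm_sub_le _ _).trans ?_
        rw [add_sub_cancel_left]
        exact add_le_add_right ((hR w hw).trans (le_abs_self R)) _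
    _ = ‖w + latticePt m‖ + (1 + |R|) / δ * δ := by field_simp; ring
    _ ≤ ‖w + latticePt m‖ + (1 + |R|) / δ * ‖w + latticePt m‖ := by gcongr
    _ = (1 + (1 + |R|) / δ) * ‖w + latticePt m‖ := by ring

lemma exists_summable_norm_inv_add_latticePt_pow_le (hK : IsCompact K)
    (hd : Disjoint K squareLattice.lattice) {r : ℕ} (hr : 2 < r) :
    ∃ c : ℤ × ℤ → ℝ, Summable c ∧ ∀ m, ∀ w ∈ K, ‖((w + latticePt m) ^ r)⁻¹‖ ≤ c m := by
  obtain ⟨C, hC, hle⟩ := exists_one_add_norm_le_mul_norm_add_latticePt hK hd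
  refine ⟨fun m => C ^ r * ((1 + ‖m‖) ^ r)⁻¹, (summable_inv_one_add_norm_pow hr).mul_left _,
    fun m w hw => ?_⟩
  have hpow : (1 + ‖m‖) ^ r ≤ C ^ r * ‖w + latticePt m‖ ^ r := by
    rw [← mul_pow]; gcongr; exact hle m w hw
  have hpos : 0 < ‖w + latticePt m‖ ^ r :=
    pos_of_mul_pos_right (lt_of_lt_of_le (by positivity) hpow) (by positivity)
  rw [norm_inv, norm_pow]
  calc (‖w + latticePt m‖ ^ r)⁻¹ = C ^ r * (C ^ r * ‖w + latticePt m‖ ^ r)⁻¹ := by field_simp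
    _ ≤ C ^ r * ((1 + ‖m‖) ^ r)⁻¹ := by gcongr

/-- A function analytic off the square lattice whose lattice translates add up to `1`. With
`x = ℘`, `y = ℘'` one has `y² = 4x³ - g₂x` and `℘'' = 6x² - g₂/2`, and the coefficients come from
the Bézout identity `2(6x² - g₂) ℘'' - 18xy ℘' = g₂²`, in which `℘''` and `℘'` are expanded as the
lattice sums of `6w⁻⁴` and `-2w⁻³`. -/
noncomputable def latticePartition (w : ℂ) : ℂ :=
  12 * (6 * squareLattice.weierstrassP w ^ 2 - squareLattice.g₂) / squareLattice.g₂ ^ 2 *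
      (w ^ 4)⁻¹ +
    36 * squareLattice.weierstrassP w * squareLattice.derivWeierstrassP w / squareLattice.g₂ ^ 2 *
      (w ^ 3)⁻¹

lemma latticePartition_add_latticePt (w : ℂ) (m : ℤ × ℤ) :
    latticePartition (w + latticePt m) =
      12 * (6 * squareLattice.weierstrassP w ^ 2 - squareLattice.g₂) / squareLattice.g₂ ^ 2 *
          ((w + latticePt m) ^ 4)⁻¹ +
        36 * squareLattice.weierstrassP w * squareLattice.derivWeierstrassP w /
          squareLattice.g₂ ^ 2 * ((w + latticePt m) ^ 3)⁻¹ := by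
  have hP := squareLattice.weierstrassP_add_coe w ⟨_, latticePt_mem_squareLattice m⟩
  have hP' := squareLattice.derivWeierstrassP_add_coe w ⟨_, latticePt_mem_squareLattice m⟩
  rw [latticePartition, hP, hP']

lemma bezout_sumInvPow {w : ℂ} (hw : w ∉ squareLattice.lattice) :
    12 * (6 * squareLattice.weierstrassP w ^ 2 - squareLattice.g₂) / squareLattice.g₂ ^ 2 *
        ((-1) ^ 4 * squareLattice.sumInvPow w 4) +
      36 * squareLattice.weierstrassP w * squareLattice.derivWeierstrassP w /
        squareLattice.g₂ ^ 2 * ((-1) ^ 3 * squareLattice.sumInvPow w 3) = 1 := by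
  have hg := g₂_squareLattice_ne_zero
  have hP' := derivWeierstrassP_eq_sumInvPow squareLattice hw
  have hP'' := (deriv_derivWeierstrassP_eq_sumInvPow squareLattice hw).symm.trans
    (deriv_derivWeierstrassP squareLattice hw)
  have hsq := squareLattice.derivWeierstrassP_sq w hw
  rw [g₃_squareLattice, sub_zero] at hsq
  field_simp
  linear_combination (18 * squareLattice.weierstrassP w * squareLattice.derivWeierstrassP w) *
      hP' + 2 * (6 * squareLattice.weierstrassP w ^ 2 - squareLattice.g₂) * hP'' -
    18 * squareLattice.weierstrassP w * hsq

lemma hasSum_latticePartition {w : ℂ} (hw : w ∉ squareLattice.lattice) :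
    HasSum (fun m => latticePartition (w + latticePt m)) 1 := by
  simp_rw [latticePartition_add_latticePt]
  rw [← bezout_sumInvPow hw]
  exact ((hasSum_inv_add_latticePt_pow w (by norm_num)).mul_left _).add
    ((hasSum_inv_add_latticePt_pow w (by norm_num)).mul_left _)

lemma differentiableOn_latticePartition :
    DifferentiableOn ℂ latticePartition (squareLattice.lattice : Set ℂ)ᶜ := by
  have hP := squareLattice.differentiableOn_weierstrassP
  have hP' := squareLattice.differentiableOn_derivWeierstrassP
  have hne : ∀ w ∈ (squareLattice.lattice : Set ℂ)ᶜ, w ≠ 0 := by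
    rintro w hw rfl; exact hw squareLattice.lattice.zero_mem
  have hinv (r : ℕ) : DifferentiableOn ℂ (fun w : ℂ => (w ^ r)⁻¹)
      (squareLattice.lattice : Set ℂ)ᶜ :=
    (differentiableOn_id.pow r).inv fun w hw => pow_ne_zero r (hne w hw)
  exact (((((hP.pow 2).const_mul 6).sub_const _).const_mul 12).div_const _ |>.mul (hinv 4)).add
    (((hP.const_mul 36).mul hP').div_const _ |>.mul (hinv 3))

lemma exists_summable_norm_latticePartition_le (hK : IsCompact K)
    (hd : Disjoint K squareLattice.lattice) :
    ∃ c : ℤ × ℤ → ℝ, Summable c ∧ ∀ m, ∀ w ∈ K, ‖latticePartition (w + latticePt m)‖ ≤ c m := by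
  have hP := squareLattice.differentiableOn_weierstrassP.continuousOn.mono hd.subset_compl_right
  have hP' :=
    squareLattice.differentiableOn_derivWeierstrassP.continuousOn.mono hd.subset_compl_right
  obtain ⟨M₄, hM₄⟩ := hK.exists_bound_of_continuousOn (f := fun w =>
    12 * (6 * squareLattice.weierstrassP w ^ 2 - squareLattice.g₂) / squareLattice.g₂ ^ 2)
    (by fun_prop)
  obtain ⟨M₃, hM₃⟩ := hK.exists_bound_of_continuousOn (f := fun w =>
    36 * squareLattice.weierstrassP w * squareLattice.derivWeierstrassP w / squareLattice.g₂ ^ 2)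
    (by fun_prop)
  obtain ⟨c₄, hc₄, hle₄⟩ :=
    exists_summable_norm_inv_add_latticePt_pow_le hK hd (r := 4) (by norm_num)
  obtain ⟨c₃, hc₃, hle₃⟩ :=
    exists_summable_norm_inv_add_latticePt_pow_le hK hd (r := 3) (by norm_num)
  refine ⟨fun m => M₄ * c₄ m + M₃ * c₃ m, (hc₄.mul_left _).add (hc₃.mul_left _), fun m w hw => ?_⟩
  rw [latticePartition_add_latticePt]
  refine (norm_add_le _ _).trans (add_le_add ?_ ?_)
  · exact norm_mul_le_of_le (hM₄ w hw) (hle₄ m w hw)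
  · exact norm_mul_le_of_le (hM₃ w hw) (hle₃ m w hw)

end Partition

lemma IsPeriodicCell.exists_analytic_partition {ϖ : Set ℂ} (h : IsPeriodicCell ϖ) :
    ∃ (ψ : ℂ → ℂ) (c : ℤ × ℤ → ℝ), DifferentiableOn ℂ ψ (periodicDomain ϖ) ∧ Summable c ∧
      (∀ m, ∀ z ∈ ϖ, ‖ψ (z + latticePt m)‖ ≤ c m) ∧
      ∀ z ∈ ϖ, HasSum (fun m => ψ (z + latticePt m)) 1 := by
  obtain ⟨V, -, ⟨a, ha⟩, hV⟩ := h.exists_hole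
  obtain ⟨haS, haϖ⟩ := hV ha
  have hsub : ∀ m z, z + latticePt m - a = z - a + latticePt m := fun m z => by ring
  have hΩ : MapsTo (fun z => z - a) (periodicDomain ϖ) (squareLattice.lattice : Set ℂ)ᶜ := by
    intro z hz hmem
    obtain ⟨m, hm⟩ := mem_squareLattice.1 hmem
    have haΩ : a ∈ periodicDomain ϖ := by
      simpa [hm] using sub_mem_periodicDomain m hz
    exact haϖ (h.mem_closure haΩ (subset_closure haS))
  have hclosure : closure ϖ ⊆ closure unitSquare := closure_mono h.subset_square
  have hcompact : IsCompact ((fun z => z - a) '' closure ϖ) :=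
    (isCompact_closure_unitSquare.of_isClosed_subset isClosed_closure hclosure).image (by fun_prop)
  have hdisjoint : Disjoint ((fun z => z - a) '' closure ϖ) squareLattice.lattice := by
    refine disjoint_left.2 ?_
    rintro _ ⟨z, hz, rfl⟩ hmem
    obtain ⟨m, hm⟩ := mem_squareLattice.1 hmem
    obtain rfl : z = a + latticePt m := by rw [hm]; ring
    obtain rfl := eq_zero_of_add_latticePt_mem_closure_unitSquare haS (hclosure hz)
    exact haϖ (by simpa using hz)
  obtain ⟨c, hc, hle⟩ := exists_summable_norm_latticePartition_le hcompact hdisjoint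
  refine ⟨fun z => latticePartition (z - a), c,
    differentiableOn_latticePartition.comp (by fun_prop) hΩ, hc, fun m z hz => ?_, fun z hz => ?_⟩
  · simp only [hsub]; exact hle m _ (mem_image_of_mem _ (subset_closure hz))
  · simp only [hsub]; exact hasSum_latticePartition (hΩ (h.subset_periodicDomain hz))

section MeanValue

open Real in
lemma setIntegral_ball_eq_polar {E : Type*} [NormedAddCommGroup E] [NormedSpace ℝ E] {f : ℂ → E}
    {z : ℂ} {r : ℝ} (hr : 0 ≤ r) (hf : ContinuousOn f (Metric.closedBall z r)) :
    ∫ w in Metric.ball z r, f w =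
      ∫ ρ in 0..r, ρ • ∫ θ in (-π)..π, f (circleMap z ρ θ) := by
  have hpolar : ∀ p ∈ polarCoord.target,
      p.1 • (Metric.ball z r).indicator f (z + Complex.polarCoord.symm p) =
        (Ioo 0 r ×ˢ Ioo (-π) π).indicator (fun p => p.1 • f (circleMap z p.1 p.2)) p := by
    rintro ⟨ρ, θ⟩ ⟨hρ, hθ⟩
    have hcircle : z + Complex.polarCoord.symm (ρ, θ) = circleMap z ρ θ := by
      rw [Complex.polarCoord_symm_apply, circleMap, exp_mul_I, ofReal_cos, ofReal_sin]
    have hmem : circleMap z ρ θ ∈ Metric.ball z r ↔ ρ < r := by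
      rw [mem_ball_iff_norm, circleMap_sub_center, norm_circleMap_zero, abs_of_pos hρ]
    rw [hcircle]
    by_cases hρr : ρ < r
    · rw [indicator_of_mem (hmem.2 hρr), indicator_of_mem (mk_mem_prod (mem_Ioo.2 ⟨hρ, hρr⟩) hθ)]
    · rw [indicator_of_notMem (mt hmem.1 hρr), smul_zero, indicator_of_notMem fun h => hρr h.1.2]
  have hint : IntegrableOn (fun p : ℝ × ℝ => p.1 • f (circleMap z p.1 p.2))
      (Ioo 0 r ×ˢ Ioo (-π) π) (volume.prod volume) := by
    refine (ContinuousOn.integrableOn_compact (isCompact_Icc.prod isCompact_Icc) ?_).mono_set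
      (prod_mono Ioo_subset_Icc_self Ioo_subset_Icc_self)
    refine continuousOn_fst.smul (hf.comp (by unfold circleMap; fun_prop) ?_)
    rintro ⟨ρ, θ⟩ ⟨hρ, -⟩
    rw [mem_closedBall_iff_norm, circleMap_sub_center, norm_circleMap_zero, abs_of_nonneg hρ.1]
    exact hρ.2
  rw [intervalIntegral.integral_of_le hr, integral_Ioc_eq_integral_Ioo]
  simp_rw [intervalIntegral.integral_of_le (neg_le_self pi_pos.le), integral_Ioc_eq_integral_Ioo,
    ← integral_smul]
  rw [← integral_indicator measurableSet_ball, ← integral_add_left_eq_self _ z,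
    ← Complex.integral_comp_polarCoord_symm,
    setIntegral_congr_fun polarCoord.open_target.measurableSet hpolar,
    setIntegral_indicator (measurableSet_Ioo.prod measurableSet_Ioo), polarCoord_target,
    inter_eq_self_of_subset_right (prod_mono (fun x hx => hx.1) subset_rfl),
    Measure.volume_eq_prod, setIntegral_prod _ hint]

open Real in
lemma setIntegral_ball_eq_of_differentiableOn {E : Type*} [NormedAddCommGroup E] [NormedSpace ℂ E]
    [CompleteSpace E] {f : ℂ → E} {z : ℂ} {r : ℝ} (hr : 0 ≤ r)
    (hf : DifferentiableOn ℂ f (Metric.closedBall z r)) :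
    ∫ w in Metric.ball z r, f w = (π * r ^ 2) • f z := by
  have hcircle : ∀ ρ ∈ Ioc 0 r, ρ • ∫ θ in (-π)..π, f (circleMap z ρ θ) = ρ • (2 * π) • f z := by
    intro ρ hρ
    have hdiff : DiffContOnCl ℂ f (Metric.ball z |ρ|) := by
      refine DifferentiableOn.diffContOnCl (hf.mono ?_)
      rw [closure_ball _ (abs_ne_zero.2 hρ.1.ne'), abs_of_pos hρ.1]
      exact Metric.closedBall_subset_closedBall hρ.2
    have hperiodic : Function.Periodic (fun θ => f (circleMap z ρ θ)) (2 * π) := fun θ => by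
      simp only [periodic_circleMap z ρ θ]
    have hshift := hperiodic.intervalIntegral_add_eq (-π) 0
    rw [zero_add, show -π + 2 * π = π by ring] at hshift
    rw [hshift, ← hdiff.circleAverage, circleAverage_def, smul_inv_smul₀ two_pi_pos.ne']
  rw [setIntegral_ball_eq_polar hr hf.continuousOn, intervalIntegral.integral_of_le hr,
    setIntegral_congr_fun measurableSet_Ioc hcircle, integral_smul_const,
    ← intervalIntegral.integral_of_le hr, integral_id, smul_smul]
  congr 1
  ring

end MeanValue

section Bergman

open Filter Topology

lemma ae_eq_of_tendsto_of_ae_tendsto {α E : Type*} [MeasurableSpace α] {μ : Measure α}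
    [NormedAddCommGroup E] {p : ℝ≥0∞} [Fact (1 ≤ p)] {u : ℕ → Lp E p μ} {f : Lp E p μ}
    (hu : Tendsto u atTop (𝓝 f)) {g : α → E}
    (hg : ∀ᵐ x ∂μ, Tendsto (fun n => u n x) atTop (𝓝 (g x))) : f =ᵐ[μ] g := by
  obtain ⟨ns, hns, hlim⟩ := (tendstoInMeasure_of_tendsto_Lp hu).exists_seq_tendsto_ae
  filter_upwards [hg, hlim] with x hx hx'
  exact tendsto_nhds_unique hx' (hx.comp hns.tendsto_atTop)

variable {D : Set ℂ} {f : L2 D} {z : ℂ} {r : ℝ}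

/-- The average over the disc `ball z r`, as a functional on `L²(D)`. -/
noncomputable def ballAvg (D : Set ℂ) (z : ℂ) (r : ℝ) : L2 D →L[ℂ] ℂ :=
  ((Real.pi * r ^ 2 : ℂ)⁻¹) • innerSL ℂ (indicatorConstLp (μ := volume.restrict D) 2
    (measurableSet_ball (x := z) (ε := r))
    ((Measure.restrict_apply_le _ _).trans_lt measure_ball_lt_top).ne 1)

lemma ballAvg_apply (hr : 0 < r) (hD : Metric.closedBall z r ⊆ D) {F : ℂ → ℂ}
    (hF : DifferentiableOn ℂ F D) (hf : f =ᵐ[volume.restrict D] F) : ballAvg D z r f = F z := by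
  have hball : Metric.ball z r ⊆ D := Metric.ball_subset_closedBall.trans hD
  have hmean : ∫ w in Metric.ball z r, f w ∂(volume.restrict D) = (Real.pi * r ^ 2 : ℂ) * F z := by
    rw [Measure.restrict_restrict measurableSet_ball, inter_eq_self_of_subset_left hball,
      integral_congr_ae (ae_restrict_of_ae_restrict_of_subset hball hf),
      setIntegral_ball_eq_of_differentiableOn hr.le (hF.mono hD), real_smul]
    push_cast
    rfl
  have hne : (Real.pi * r ^ 2 : ℂ) ≠ 0 := by
    exact_mod_cast (mul_pos Real.pi_pos (pow_pos hr 2)).ne'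
  rw [ballAvg, smul_apply, innerSL_apply_apply, L2.inner_indicatorConstLp_one,
    hmean, smul_eq_mul, inv_mul_cancel_left₀ hne]

lemma exists_norm_ballAvg_le (D : Set ℂ) (r : ℝ) : ∃ C, ∀ z, ‖ballAvg D z r‖ ≤ C := by
  refine ⟨‖((Real.pi * r ^ 2 : ℂ)⁻¹)‖ * (volume.real (Metric.ball (0 : ℂ) r)) ^ (1 / 2 : ℝ),
    fun z => ?_⟩
  have hvol : volume.real (Metric.ball (0 : ℂ) r) = volume.real (Metric.ball z r) := by
    simp only [Measure.real, Complex.volume_ball]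
  rw [ballAvg, norm_smul, innerSL_apply_norm, norm_indicatorConstLp (by norm_num) (by norm_num),
    norm_one, one_mul, ENNReal.toReal_ofNat, hvol]
  gcongr
  exact ENNReal.toReal_mono measure_ball_lt_top.ne (Measure.restrict_apply_le _ _)

lemma differentiableOn_analyticRep (hf : f ∈ bergmanSpace D) :
    DifferentiableOn ℂ (analyticRep D f) D := by
  rw [analyticRep, dif_pos hf]; exact (Exists.choose_spec hf).1

lemma ae_eq_analyticRep (hf : f ∈ bergmanSpace D) : f =ᵐ[volume.restrict D] analyticRep D f := by
  rw [analyticRep, dif_pos hf]; exact (Exists.choose_spec hf).2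

lemma ballAvg_eq_analyticRep (hr : 0 < r) (hD : Metric.closedBall z r ⊆ D)
    (hf : f ∈ bergmanSpace D) : ballAvg D z r f = analyticRep D f z :=
  ballAvg_apply hr hD (differentiableOn_analyticRep hf) (ae_eq_analyticRep hf)

lemma tendsto_analyticRep_ballAvg {ι : Type*} {l : Filter ι} {u : ι → L2 D}
    (hu : ∀ n, u n ∈ bergmanSpace D) (hlim : Tendsto u l (𝓝 f)) (hr : 0 < r)
    (hD : Metric.closedBall z r ⊆ D) :
    Tendsto (fun n => analyticRep D (u n) z) l (𝓝 (ballAvg D z r f)) :=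
  (((ballAvg D z r).continuous.tendsto f).comp hlim).congr fun n =>
    ballAvg_eq_analyticRep hr hD (hu n)

lemma exists_tendstoLocallyUniformlyOn_analyticRep {ι : Type*} {l : Filter ι} [l.NeBot]
    (hD : IsOpen D) {u : ι → L2 D} (hu : ∀ n, u n ∈ bergmanSpace D) (hlim : Tendsto u l (𝓝 f)) :
    ∃ g : ℂ → ℂ, TendstoLocallyUniformlyOn (fun n => analyticRep D (u n)) g l D := by
  have hball : ∀ z ∈ D, ∃ r > 0, Metric.closedBall z r ⊆ D := fun z hz =>
    Metric.nhds_basis_closedBall.mem_iff.1 (hD.mem_nhds hz)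
  choose! r hr hrD using hball
  refine ⟨fun z => ballAvg D z (r z) f, Metric.tendstoLocallyUniformlyOn_iff.2 fun ε hε z hz => ?_⟩
  have hr2 : 0 < r z / 2 := half_pos (hr z hz)
  obtain ⟨C, hC⟩ := exists_norm_ballAvg_le D (r z / 2)
  have hC0 : 0 ≤ C := (norm_nonneg _).trans (hC 0)
  have hclose : ∀ᶠ n in l, dist (u n) f < ε / (C + 1) :=
    hlim.eventually (Metric.ball_mem_nhds f (by positivity))
  refine ⟨Metric.ball z (r z / 2), mem_nhdsWithin_of_mem_nhds (Metric.ball_mem_nhds z hr2), ?_⟩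
  filter_upwards [hclose] with n hn w hw
  have hwD : Metric.closedBall w (r z / 2) ⊆ D := by
    refine (Metric.closedBall_subset_closedBall' ?_).trans (hrD z hz)
    linarith [Metric.mem_ball.1 hw]
  have hw' : w ∈ D := hwD (Metric.mem_closedBall_self hr2.le)
  have hradius : ballAvg D w (r w) f = ballAvg D w (r z / 2) f :=
    tendsto_nhds_unique (tendsto_analyticRep_ballAvg hu hlim (hr w hw') (hrD w hw'))
      (tendsto_analyticRep_ballAvg hu hlim hr2 hwD)
  rw [hradius, ← ballAvg_eq_analyticRep hr2 hwD (hu n), dist_eq_norm, ← map_sub]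
  calc ‖ballAvg D w (r z / 2) (f - u n)‖
      ≤ C * ‖f - u n‖ := (ballAvg D w (r z / 2)).le_of_opNorm_le (hC w) _
    _ ≤ (C + 1) * ‖f - u n‖ := by gcongr; linarith
    _ < (C + 1) * (ε / (C + 1)) := by rw [← dist_eq_norm, dist_comm]; gcongr
    _ = ε := by field_simp

lemma isClosed_bergmanSpace (hD : IsOpen D) : IsClosed (bergmanSpace D : Set (L2 D)) := by
  refine IsSeqClosed.isClosed fun u f hu hlim => ?_
  obtain ⟨g, hg⟩ := exists_tendstoLocallyUniformlyOn_analyticRep hD hu hlim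
  refine ⟨g, hg.differentiableOn (.of_forall fun n => differentiableOn_analyticRep (hu n)) hD,
    ae_eq_of_tendsto_of_ae_tendsto hlim ?_⟩
  filter_upwards [ae_all_iff.2 fun n => ae_eq_analyticRep (hu n),
    ae_restrict_mem hD.measurableSet] with z hz hzD
  simp only [hz]
  exact hg.tendsto_at hzD

end Bergman

section Phase

lemma isCompact_floquetBox : IsCompact floquetBox := isCompact_Icc.prod isCompact_Icc

instance isFiniteMeasure_restrict_floquetBox :
    IsFiniteMeasure (volume.restrict floquetBox : Measure (ℝ × ℝ)) :=
  isFiniteMeasure_restrict.2 isCompact_floquetBox.measure_lt_top.ne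

@[fun_prop]
lemma continuous_phase (m : ℤ × ℤ) : Continuous fun η => phase η m := by unfold phase; fun_prop

@[simp] lemma phase_zero (η : ℝ × ℝ) : phase η 0 = 0 := by simp [phase]

lemma phase_add (η : ℝ × ℝ) (m n : ℤ × ℤ) : phase η (m + n) = phase η m + phase η n := by
  simp only [phase, Prod.fst_add, Prod.snd_add]; push_cast; ring

lemma phase_neg (η : ℝ × ℝ) (m : ℤ × ℤ) : phase η (-m) = -phase η m := by
  simp only [phase, Prod.fst_neg, Prod.snd_neg]; push_cast; ring

lemma phase_sub (η : ℝ × ℝ) (m n : ℤ × ℤ) : phase η (m - n) = phase η m - phase η n := by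
  rw [sub_eq_add_neg, phase_add, phase_neg, sub_eq_add_neg]

lemma conj_exp_neg_mul_I (x : ℝ) : (starRingEnd ℂ) (exp (-(x : ℂ) * I)) = exp ((x : ℂ) * I) := by
  rw [← exp_conj]; simp

lemma integral_exp_mul_int (n : ℤ) :
    ∫ x in Icc (-Real.pi) Real.pi, exp ((x * n : ℝ) * I) =
      if n = 0 then (2 * Real.pi : ℂ) else 0 := by
  rw [integral_Icc_eq_integral_Ioc,
    ← intervalIntegral.integral_of_le (neg_le_self Real.pi_pos.le)]
  split_ifs with hn
  · subst hn; simp; ring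
  · have hne : (n : ℂ) * I ≠ 0 := mul_ne_zero (by exact_mod_cast hn) I_ne_zero
    have hcomm : ∀ x : ℝ, exp ((x * n : ℝ) * I) = exp (n * I * x) := fun x => by
      push_cast; congr 1; ring
    have hperiod : (n * I * (Real.pi : ℝ) : ℂ) =
        n * I * (-Real.pi : ℝ) + n * (2 * Real.pi * I) := by
      push_cast; ring
    simp_rw [hcomm]
    rw [integral_exp_mul_complex hne, hperiod, exp_add, exp_int_mul_two_pi_mul_I, mul_one,
      sub_self, zero_div]

lemma integral_exp_phase (m : ℤ × ℤ) :
    ∫ η in floquetBox, exp ((phase η m : ℂ) * I) = if m = 0 then (2 * Real.pi : ℂ) ^ 2 else 0 := by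
  have hsplit : ∀ η : ℝ × ℝ, exp ((phase η m : ℂ) * I) =
      exp ((η.1 * m.1 : ℝ) * I) * exp ((η.2 * m.2 : ℝ) * I) := fun η => by
    rw [← exp_add, phase]; push_cast; congr 1; ring
  simp_rw [hsplit]
  rw [floquetBox, Measure.volume_eq_prod,
    setIntegral_prod_mul (fun x : ℝ => exp ((x * m.1 : ℝ) * I))
      (fun x : ℝ => exp ((x * m.2 : ℝ) * I)), integral_exp_mul_int, integral_exp_mul_int,
    ite_zero_mul_ite_zero, sq]
  simp only [Prod.ext_iff, Prod.fst_zero, Prod.snd_zero]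

end Phase

section Term

variable {D D' : Set ℂ}

lemma inner_term_term (m k : ℤ × ℤ) (v w : L2 D) :
    inner ℂ ((memLp_term m v).toLp _ : BochnerL2 D) ((memLp_term k w).toLp _ : BochnerL2 D) =
      if m = k then inner ℂ v w else 0 := by
  have hconj : (starRingEnd ℂ) (1 / (2 * Real.pi) : ℂ) = 1 / (2 * Real.pi) := by
    simp [Complex.conj_ofNat]
  have hae : ∀ᵐ η ∂(volume.restrict floquetBox),
      inner ℂ (((memLp_term m v).toLp _ : BochnerL2 D) η)
        (((memLp_term k w).toLp _ : BochnerL2 D) η) =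
      exp ((phase η (m - k) : ℂ) * I) * ((1 / (2 * Real.pi)) ^ 2 * inner ℂ v w) := by
    filter_upwards [(memLp_term m v).coeFn_toLp, (memLp_term k w).coeFn_toLp] with η hv hw
    rw [hv, hw, inner_smul_left, inner_smul_right, map_mul, conj_exp_neg_mul_I, hconj, phase_sub,
      ofReal_sub, sub_mul, sub_eq_add_neg, exp_add, neg_mul]
    ring
  have hpi : (Real.pi : ℂ) ≠ 0 := ofReal_ne_zero.2 Real.pi_ne_zero
  rw [L2.inner_def, integral_congr_ae hae, integral_mul_const, integral_exp_phase]
  simp only [sub_eq_zero]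
  split_ifs
  · field_simp
  · rw [zero_mul]

/-- The isometry `v ↦ (2π)⁻¹ e^{-i η₁ m₁ - i η₂ m₂} v` into the Bochner space; the terms of the
Floquet series are its values. -/
noncomputable def termL (D : Set ℂ) (m : ℤ × ℤ) : L2 D →ₗᵢ[ℂ] BochnerL2 D :=
  LinearMap.isometryOfInner
    { toFun := fun v => (memLp_term m v).toLp _
      map_add' := fun v w => by
        rw [← MemLp.toLp_add]
        exact MemLp.toLp_congr _ _ (.of_forall fun η => smul_add _ _ _)
      map_smul' := fun c v => by
        rw [RingHom.id_apply, ← MemLp.toLp_const_smul]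
        exact MemLp.toLp_congr _ _ (.of_forall fun η => smul_comm _ _ _) }
    (fun v w => by simpa using inner_term_term m m v w)

lemma coeFn_termL (m : ℤ × ℤ) (v : L2 D) :
    termL D m v =ᵐ[volume.restrict floquetBox]
      fun η : ℝ × ℝ => ((1 / (2 * Real.pi) : ℂ) * exp (-(phase η m : ℂ) * I)) • v :=
  (memLp_term m v).coeFn_toLp

lemma inner_termL_left (m : ℤ × ℤ) (v : L2 D) (g : BochnerL2 D) :
    inner ℂ (termL D m v) g = (1 / (2 * Real.pi) : ℂ) *
      ∫ η in floquetBox, exp ((phase η m : ℂ) * I) * inner ℂ v (g η) := by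
  have hconj : (starRingEnd ℂ) (1 / (2 * Real.pi) : ℂ) = 1 / (2 * Real.pi) := by
    simp [Complex.conj_ofNat]
  rw [L2.inner_def, ← integral_const_mul]
  refine integral_congr_ae ?_
  filter_upwards [coeFn_termL m v] with η hη
  rw [hη, inner_smul_left, map_mul, conj_exp_neg_mul_I, hconj, mul_assoc]

lemma orthogonalFamily_termL (D : Set ℂ) :
    OrthogonalFamily ℂ (fun _ : ℤ × ℤ => L2 D) (termL D) := fun m k hmk v w =>
  (inner_term_term m k v w).trans (if_neg hmk)

lemma compLpL_termL (L : L2 D →L[ℂ] L2 D') (m : ℤ × ℤ) (v : L2 D) :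
    L.compLpL 2 (volume.restrict floquetBox) (termL D m v) = termL D' m (L v) := by
  refine Lp.ext ?_
  filter_upwards [L.coeFn_compLpL (termL D m v), coeFn_termL m v, coeFn_termL m (L v)]
    with η hcomp hv hLv
  rw [hcomp, hv, hLv, map_smul]

lemma memLp_mulPhase (k : ℤ × ℤ) (g : BochnerL2 D) :
    MemLp (fun η : ℝ × ℝ => exp ((phase η k : ℂ) * I) • g η) 2 (volume.restrict floquetBox) := by
  have hexp : Continuous fun η => exp ((phase η k : ℂ) * I) := by fun_prop
  refine (Lp.memLp g).of_le (hexp.aestronglyMeasurable.smul (Lp.memLp g).1)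
    (.of_forall fun η => ?_)
  rw [norm_smul, norm_exp_ofReal_mul_I, one_mul]

/-- Multiplication by `e^{i η₁ k₁ + i η₂ k₂}` on the Bochner space; it shifts the index of the
Floquet series by `k`. -/
noncomputable def mulPhase (D : Set ℂ) (k : ℤ × ℤ) : BochnerL2 D →L[ℂ] BochnerL2 D :=
  LinearMap.mkContinuous
    { toFun := fun g => (memLp_mulPhase k g).toLp _
      map_add' := fun f g => by
        rw [← MemLp.toLp_add]
        refine MemLp.toLp_congr _ _ ?_
        filter_upwards [Lp.coeFn_add f g] with η hη
        simp only [hη, Pi.add_apply, smul_add]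
      map_smul' := fun c f => by
        rw [RingHom.id_apply, ← MemLp.toLp_const_smul]
        refine MemLp.toLp_congr _ _ ?_
        filter_upwards [Lp.coeFn_smul c f] with η hη
        simp only [hη, Pi.smul_apply, smul_comm _ c] }
    1 (fun g => by
      rw [one_mul]
      refine Lp.norm_le_norm_of_ae_le ?_
      filter_upwards [(memLp_mulPhase k g).coeFn_toLp] with η hη
      rw [LinearMap.coe_mk, AddHom.coe_mk, hη, norm_smul, norm_exp_ofReal_mul_I, one_mul])

lemma coeFn_mulPhase (k : ℤ × ℤ) (g : BochnerL2 D) :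
    mulPhase D k g =ᵐ[volume.restrict floquetBox]
      fun η : ℝ × ℝ => exp ((phase η k : ℂ) * I) • g η :=
  (memLp_mulPhase k g).coeFn_toLp

lemma mulPhase_termL (k m : ℤ × ℤ) (v : L2 D) :
    mulPhase D k (termL D m v) = termL D (m - k) v := by
  refine Lp.ext ?_
  filter_upwards [coeFn_mulPhase k (termL D m v), coeFn_termL m v, coeFn_termL (m - k) v]
    with η hmul hm hmk
  rw [hmul, hm, hmk, smul_smul, phase_sub, ofReal_sub, neg_sub, sub_mul, sub_eq_add_neg, exp_add,
    neg_mul, mul_left_comm]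

end Term

section Fourier

section Torus

variable {d : Type*} [Fintype d]

lemma span_toLp_mFourier_closure_eq_top (ν : Measure (UnitAddTorus d)) [IsFiniteMeasure ν]
    {p : ℝ≥0∞} [Fact (1 ≤ p)] (hp : p ≠ ∞) :
    (Submodule.span ℂ (range fun n =>
      ContinuousMap.toLp (E := ℂ) p ν ℂ (UnitAddTorus.mFourier n))).topologicalClosure = ⊤ := by
  have hdense := (ContinuousMap.toLp_denseRange ℂ ν ℂ hp).topologicalClosure_map_submodule
    (UnitAddTorus.span_mFourier_closure_eq_top (d := d))
  rwa [Submodule.map_span, ← range_comp] at hdense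

lemma ae_eq_zero_of_forall_integral_mFourier_mul {ν : Measure (UnitAddTorus d)}
    [IsFiniteMeasure ν] {f : UnitAddTorus d → ℂ} (hf : MemLp f 2 ν)
    (hzero : ∀ n, ∫ x, UnitAddTorus.mFourier n x * f x ∂ν = 0) : f =ᵐ[ν] 0 := by
  have hinner : ∀ n : d → ℤ,
      inner ℂ (ContinuousMap.toLp (E := ℂ) 2 ν ℂ (UnitAddTorus.mFourier n)) (hf.toLp f) = 0 := by
    intro n
    rw [L2.inner_def, ← hzero (-n)]
    refine integral_congr_ae ?_
    filter_upwards [hf.coeFn_toLp, ContinuousMap.coeFn_toLp (p := 2) (𝕜 := ℂ) ν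
      (UnitAddTorus.mFourier n)] with x hfx hnx
    rw [hfx, hnx, UnitAddTorus.mFourier_neg, RCLike.inner_apply, mul_comm]
  have hdense := Submodule.dense_iff_topologicalClosure_eq_top.2
    (span_toLp_mFourier_closure_eq_top ν (p := 2) (by norm_num))
  have hf0 : hf.toLp f = 0 := hdense.eq_zero_of_inner_right ℂ fun v hv => by
    induction hv using Submodule.span_induction with
    | mem v hv => obtain ⟨n, rfl⟩ := hv; exact hinner n
    | zero => exact inner_zero_left _
    | add v w _ _ hv hw => rw [inner_add_left, hv, hw, add_zero]
    | smul c v _ hv => rw [inner_smul_left, hv, mul_zero]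
  exact hf.coeFn_toLp.symm.trans (hf0 ▸ Lp.coeFn_zero ℂ 2 ν)

end Torus

/-- The covering map of the two-dimensional torus by the parameter plane, with period `2π` in each
variable. -/
noncomputable def toTorus (η : ℝ × ℝ) : UnitAddTorus (Fin 2) :=
  ![((η.1 / (2 * Real.pi) : ℝ) : UnitAddCircle), ((η.2 / (2 * Real.pi) : ℝ) : UnitAddCircle)]

/-- The section of the covering map `toTorus` with values in `(-π, π]²`. -/
noncomputable def ofTorus (x : UnitAddTorus (Fin 2)) : ℝ × ℝ :=
  (2 * Real.pi * (AddCircle.measurableEquivIoc 1 (-1 / 2) (x 0) : ℝ),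
    2 * Real.pi * (AddCircle.measurableEquivIoc 1 (-1 / 2) (x 1) : ℝ))

lemma continuous_toTorus : Continuous toTorus := by
  refine continuous_pi fun i => ?_
  fin_cases i <;> exact (AddCircle.continuous_mk' 1).comp (by fun_prop)

lemma mFourier_toTorus (n : Fin 2 → ℤ) (η : ℝ × ℝ) :
    UnitAddTorus.mFourier n (toTorus η) = exp ((phase η (n 0, n 1) : ℂ) * I) := by
  have hpi : (Real.pi : ℂ) ≠ 0 := ofReal_ne_zero.2 Real.pi_ne_zero
  simp only [UnitAddTorus.mFourier, ContinuousMap.coe_mk, Fin.prod_univ_two, toTorus,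
    Matrix.cons_val_zero, Matrix.cons_val_one, fourier_coe_apply, ← exp_add, phase]
  congr 1
  push_cast
  field_simp

lemma measurable_ofTorus : Measurable ofTorus := by
  have hcoord : ∀ i : Fin 2, Measurable fun x : UnitAddTorus (Fin 2) =>
      (AddCircle.measurableEquivIoc 1 (-1 / 2) (x i) : ℝ) := fun i =>
    measurable_subtype_coe.comp
      ((AddCircle.measurableEquivIoc (1 : ℝ) (-1 / 2)).measurable.comp (measurable_pi_apply i))
  exact ((hcoord 0).const_mul _).prodMk ((hcoord 1).const_mul _)

open Real in
lemma ofTorus_toTorus {η : ℝ × ℝ} (hη : η ∈ Ioc (-π) π ×ˢ Ioc (-π) π) :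
    ofTorus (toTorus η) = η := by
  have hcoord : ∀ x ∈ Ioc (-π) π, 2 * π *
      (AddCircle.equivIoc (1 : ℝ) (-1 / 2) ((x / (2 * π) : ℝ) : UnitAddCircle) : ℝ) = x := by
    intro x hx
    have hx' : x / (2 * π) ∈ Ioc (-1 / 2 : ℝ) (-1 / 2 + 1) := by
      constructor
      · rw [lt_div_iff₀ two_pi_pos]; linarith [hx.1]
      · rw [div_le_iff₀ two_pi_pos]; linarith [hx.2]
    rw [AddCircle.equivIoc_coe_of_mem hx', mul_div_cancel₀ _ two_pi_pos.ne']
  exact Prod.ext (hcoord _ hη.1) (hcoord _ hη.2)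

open Real in
lemma floquetBox_ae_eq : (floquetBox : Set (ℝ × ℝ)) =ᵐ[volume] Ioc (-π) π ×ˢ Ioc (-π) π := by
  rw [floquetBox, Measure.volume_eq_prod]
  exact Measure.set_prod_ae_eq Ioc_ae_eq_Icc.symm Ioc_ae_eq_Icc.symm

lemma ae_ofTorus_toTorus :
    ∀ᵐ η ∂(volume.restrict floquetBox), ofTorus (toTorus η) = η := by
  rw [Measure.restrict_congr_set floquetBox_ae_eq]
  filter_upwards [ae_restrict_mem (measurableSet_Ioc.prod measurableSet_Ioc)] with η hη
  exact ofTorus_toTorus hη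

lemma ae_eq_zero_of_forall_integral_exp_phase {s : ℝ × ℝ → ℂ}
    (hs : MemLp s 2 (volume.restrict floquetBox))
    (hzero : ∀ k, ∫ η in floquetBox, exp ((phase η k : ℂ) * I) * s η = 0) :
    s =ᵐ[volume.restrict floquetBox] 0 := by
  have hq := continuous_toTorus.aemeasurable (μ := volume.restrict floquetBox)
  set ν : Measure (UnitAddTorus (Fin 2)) := (volume.restrict floquetBox).map toTorus with hν
  obtain ⟨t, ht, hst⟩ := hs.1
  have htorus : ∀ᵐ η ∂(volume.restrict floquetBox), t (ofTorus (toTorus η)) = s η := by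
    filter_upwards [ae_ofTorus_toTorus, hst] with η hη hη'
    rw [hη, hη']
  have hmeas : AEStronglyMeasurable (t ∘ ofTorus) ν :=
    (ht.comp_measurable measurable_ofTorus).aestronglyMeasurable
  have hLp : MemLp (t ∘ ofTorus) 2 ν :=
    (memLp_map_measure_iff hmeas hq).2 (hs.ae_eq (htorus.mono fun η hη => hη.symm))
  have ht0 : t ∘ ofTorus =ᵐ[ν] 0 := by
    refine ae_eq_zero_of_forall_integral_mFourier_mul hLp fun n => ?_
    rw [hν, integral_map hq
      ((UnitAddTorus.mFourier n).continuous.aestronglyMeasurable.fun_mul hmeas), ← hzero (n 0, n 1)]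
    refine integral_congr_ae ?_
    filter_upwards [htorus] with η hη
    rw [mFourier_toTorus, Function.comp_apply, hη]
  filter_upwards [htorus, ae_of_ae_map hq ht0] with η hη hη'
  rw [← hη]
  exact hη'

end Fourier

section NormSquare

lemma enorm_sq_toReal {E : Type*} [SeminormedAddGroup E] (x : E) :
    (‖x‖ₑ ^ 2).toReal = ‖x‖ ^ 2 := by
  rw [ENNReal.toReal_pow, toReal_enorm]

lemma enorm_sq_eq_lintegral {α E : Type*} [MeasurableSpace α] {μ : Measure α}
    [NormedAddCommGroup E] (f : Lp E 2 μ) : ‖f‖ₑ ^ 2 = ∫⁻ x, ‖f x‖ₑ ^ 2 ∂μ := by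
  simpa [Lp.enorm_def] using
    eLpNorm_nnreal_pow_eq_lintegral (f := f) (μ := μ) (p := 2) two_ne_zero

lemma enorm_sq_translateL {D D' : Set ℂ} {k : ℂ} (h : MapsTo (fun z => z + k) D' D) (f : L2 D) :
    ‖translateL k h f‖ₑ ^ 2 = ∫⁻ z in D', ‖f (z + k)‖ₑ ^ 2 := by
  rw [enorm_sq_eq_lintegral]
  refine lintegral_congr_ae ?_
  filter_upwards [coeFn_translateL h f] with z hz
  rw [hz]

variable {ϖ : Set ℂ}

lemma hasSum_norm_sq_shift (h : IsPeriodicCell ϖ)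
    (hnull : volume (periodicDomain ϖ \ ⋃ m : ℤ × ℤ, cellTranslate ϖ m) = 0)
    (f : L2 (periodicDomain ϖ)) : HasSum (fun m => ‖shift h m f‖ ^ 2) (‖f‖ ^ 2) := by
  have htsum : ∑' m, ‖shift h m f‖ₑ ^ 2 = ‖f‖ₑ ^ 2 := by
    rw [enorm_sq_eq_lintegral, h.lintegral_periodicDomain hnull]
    exact tsum_congr fun m => by rw [h.shift_eq_translateL, enorm_sq_translateL]
  have hfin : ∑' m, ‖shift h m f‖ₑ ^ 2 ≠ ∞ := htsum ▸ ENNReal.pow_ne_top enorm_ne_top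
  have hsum := ENNReal.hasSum_toReal hfin
  rw [← ENNReal.tsum_toReal_eq (ENNReal.ne_top_of_tsum_ne_top hfin), htsum] at hsum
  simpa only [enorm_sq_toReal] using hsum

/-- A square containing the closed unit square in its interior. -/
def bigSquare : Set ℂ := Ioo (-1 : ℝ) 2 ×ℂ Ioo (-1 : ℝ) 2

lemma isOpen_bigSquare : IsOpen bigSquare := isOpen_Ioo.reProdIm isOpen_Ioo

lemma closure_unitSquare_subset_bigSquare : closure unitSquare ⊆ bigSquare := by
  rw [closure_unitSquare]
  exact reProdIm_subset_iff.2 (prod_mono (Icc_subset_Ioo (by norm_num) (by norm_num))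
    (Icc_subset_Ioo (by norm_num) (by norm_num)))

lemma add_latticePt_mem_bigSquare {z : ℂ} (hz : z ∈ unitSquare) {m : ℤ × ℤ}
    (hm : z + latticePt m ∈ bigSquare) : m ∈ Finset.Icc (-1 : ℤ) 1 ×ˢ Finset.Icc (-1 : ℤ) 1 := by
  obtain ⟨⟨hre, hre'⟩, him, him'⟩ := hz
  obtain ⟨⟨kre, kre'⟩, kim, kim'⟩ := mem_reProdIm.1 hm
  simp only [add_re, add_im, latticePt_re, latticePt_im] at kre kre' kim kim'
  have lower₁ : (-2 : ℝ) < m.1 := by linarith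
  have upper₁ : (m.1 : ℝ) < 2 := by linarith
  have lower₂ : (-2 : ℝ) < m.2 := by linarith
  have upper₂ : (m.2 : ℝ) < 2 := by linarith
  norm_cast at lower₁ upper₁ lower₂ upper₂
  simp only [Finset.mem_product, Finset.mem_Icc]
  lia

/-- The part of the periodic domain near the closed unit square: an open neighbourhood, in the
periodic domain, of the closed cell, to which the Floquet series extends. -/
def cellNhd (ϖ : Set ℂ) : Set ℂ := periodicDomain ϖ ∩ bigSquare

lemma isOpen_cellNhd (ϖ : Set ℂ) : IsOpen (cellNhd ϖ) :=
  (isOpen_periodicDomain ϖ).inter isOpen_bigSquare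

lemma mem_cellNhd {z : ℂ} (hz : z ∈ periodicDomain ϖ) (hz' : z ∈ closure unitSquare) :
    z ∈ cellNhd ϖ :=
  ⟨hz, closure_unitSquare_subset_bigSquare hz'⟩

lemma IsPeriodicCell.lintegral_cellNhd_le (h : IsPeriodicCell ϖ)
    (hnull : volume (periodicDomain ϖ \ ⋃ m : ℤ × ℤ, cellTranslate ϖ m) = 0) (u : ℂ → ℝ≥0∞) :
    ∫⁻ z in cellNhd ϖ, u z ≤ ∑ n ∈ Finset.Icc (-1 : ℤ) 1 ×ˢ Finset.Icc (-1 : ℤ) 1,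
      ∫⁻ z in ϖ, u (z + latticePt n) := by
  have hsplit : ∫⁻ z in cellNhd ϖ, u z =
      ∑' n, ∫⁻ z in ϖ, bigSquare.indicator u (z + latticePt n) := by
    rw [← h.lintegral_periodicDomain hnull, setLIntegral_indicator isOpen_bigSquare.measurableSet,
      inter_comm, cellNhd]
  rw [hsplit, tsum_eq_sum]
  · exact Finset.sum_le_sum fun n _ => lintegral_mono fun z => indicator_le_self _ _ _
  · intro n hn
    refine setLIntegral_eq_zero h.isOpen.measurableSet fun z hz => indicator_of_notMem ?_ _
    exact mt (add_latticePt_mem_bigSquare (h.subset_square hz)) hn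

lemma mapsTo_add_latticePt_cellNhd (ϖ : Set ℂ) (m : ℤ × ℤ) :
    MapsTo (fun z => z + latticePt m) (cellNhd ϖ) (periodicDomain ϖ) :=
  fun _ hz => add_mem_periodicDomain m hz.1

/-- The element `z ↦ f(z + m)` of `L²` of the neighbourhood of the cell. -/
noncomputable def nhdShift (ϖ : Set ℂ) (m : ℤ × ℤ) :
    L2 (periodicDomain ϖ) →L[ℂ] L2 (cellNhd ϖ) :=
  translateL (latticePt m) (mapsTo_add_latticePt_cellNhd ϖ m)

lemma summable_norm_sq_nhdShift (h : IsPeriodicCell ϖ)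
    (hnull : volume (periodicDomain ϖ \ ⋃ m : ℤ × ℤ, cellTranslate ϖ m) = 0)
    (f : L2 (periodicDomain ϖ)) : Summable fun m => ‖nhdShift ϖ m f‖ ^ 2 := by
  set B : Finset (ℤ × ℤ) := Finset.Icc (-1 : ℤ) 1 ×ˢ Finset.Icc (-1 : ℤ) 1
  have hle : ∀ m, ‖nhdShift ϖ m f‖ₑ ^ 2 ≤
      ∑ n ∈ B, ∫⁻ z in ϖ, ‖f (z + latticePt (n + m))‖ₑ ^ 2 := fun m => by
    rw [nhdShift, enorm_sq_translateL]
    simpa only [latticePt_add, ← add_assoc] using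
      h.lintegral_cellNhd_le hnull fun z => ‖f (z + latticePt m)‖ₑ ^ 2
  have htranslate : ∀ n, ∑' m, ∫⁻ z in ϖ, ‖f (z + latticePt (n + m))‖ₑ ^ 2 = ‖f‖ₑ ^ 2 := fun n => by
    rw [enorm_sq_eq_lintegral, h.lintegral_periodicDomain hnull]
    exact (Equiv.addLeft n).tsum_eq fun m => ∫⁻ z in ϖ, ‖f (z + latticePt m)‖ₑ ^ 2
  have hfin : ∑' m, ‖nhdShift ϖ m f‖ₑ ^ 2 ≠ ∞ := by
    refine ne_top_of_le_ne_top ?_ (ENNReal.tsum_le_tsum hle)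
    rw [Summable.tsum_finsetSum fun _ _ => ENNReal.summable]
    simp only [htranslate]
    exact ENNReal.sum_ne_top.2 fun _ _ => ENNReal.pow_ne_top enorm_ne_top
  simpa only [enorm_sq_toReal] using ENNReal.summable_toReal hfin

end NormSquare

section TermSeries

variable {D D' : Set ℂ} {u : ℤ × ℤ → L2 D} {S : BochnerL2 D}

lemma hasSum_compLpL_termL (L : L2 D →L[ℂ] L2 D') (hS : HasSum (fun m => termL D m (u m)) S) :
    HasSum (fun m => termL D' m (L (u m))) (L.compLpL 2 (volume.restrict floquetBox) S) := by
  simpa only [compLpL_termL] using (L.compLpL 2 (volume.restrict floquetBox)).hasSum hS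

lemma hasSum_mulPhase_termL (k : ℤ × ℤ) (hS : HasSum (fun m => termL D m (u m)) S) :
    HasSum (fun m => termL D m (u (m + k))) (mulPhase D k S) := by
  have hsum := (mulPhase D k).hasSum hS
  rw [← (Equiv.addRight k).hasSum_iff] at hsum
  simpa only [Function.comp_def, mulPhase_termL, Equiv.coe_addRight, add_sub_cancel_right]
    using hsum

lemma ae_mem_of_hasSum_termL {K : Submodule ℂ (L2 D)} (hK : IsClosed (K : Set (L2 D)))
    (hu : ∀ m, u m ∈ K) (hS : HasSum (fun m => termL D m (u m)) S) :
    ∀ᵐ η ∂(volume.restrict floquetBox), S η ∈ K := by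
  have : CompleteSpace K := hK.completeSpace_coe
  have hproj : ∀ v, Kᗮ.starProjection v = 0 ↔ v ∈ K := fun v => by
    rw [Submodule.starProjection_apply_eq_zero_iff, Submodule.orthogonal_orthogonal]
  have hsum := hasSum_compLpL_termL Kᗮ.starProjection hS
  simp only [(hproj _).2 (hu _), map_zero] at hsum
  filter_upwards [Kᗮ.starProjection.coeFn_compLpL (p := 2) (μ := volume.restrict floquetBox) S,
    Lp.coeFn_zero (L2 D) 2 (volume.restrict floquetBox)] with η hη hη0
  rw [← hproj, ← hη, hsum.unique hasSum_zero, hη0, Pi.zero_apply]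

lemma ae_eq_smul_of_hasSum_termL (A B : L2 D →L[ℂ] L2 D') (k : ℤ × ℤ)
    (hu : ∀ m, B (u m) = A (u (m + k))) (hS : HasSum (fun m => termL D m (u m)) S) :
    ∀ᵐ η ∂(volume.restrict floquetBox), B (S η) = exp ((phase η k : ℂ) * I) • A (S η) := by
  have hsum := hasSum_mulPhase_termL k (hasSum_compLpL_termL A hS)
  simp only [← hu] at hsum
  have heq := (hasSum_compLpL_termL B hS).unique hsum
  filter_upwards [B.coeFn_compLpL (p := 2) (μ := volume.restrict floquetBox) S,
    A.coeFn_compLpL (p := 2) (μ := volume.restrict floquetBox) S,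
    coeFn_mulPhase k (A.compLpL 2 (volume.restrict floquetBox) S)] with η hB hA hmul
  rw [← hB, heq, hmul, hA]

end TermSeries

section FloquetIsometry

variable {ϖ : Set ℂ}

lemma bergmanExt_le_bergmanEta (ϖ : Set ℂ) (η : ℝ × ℝ) : bergmanExt ϖ η ≤ bergmanEta ϖ η :=
  fun _ hf => ⟨Submodule.le_topologicalClosure _ hf, hf.1⟩

lemma mapsTo_add_zero {s t : Set ℂ} (hst : s ⊆ t) : MapsTo (fun z => z + 0) s t := fun z hz => by
  simpa using hst hz

lemma analyticRep_add_eq_mul {W : Set ℂ} (hW : IsOpen W) {v : L2 W} (hv : v ∈ bergmanSpace W)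
    {k c z : ℂ}
    (hk : ∀ᵐ w ∂(volume.restrict (W ∩ (fun w => w + k) ⁻¹' W)), v (w + k) = c * v w)
    (hz : z ∈ W) (hz' : z + k ∈ W) : analyticRep W v (z + k) = c * analyticRep W v z := by
  have hcont := (differentiableOn_analyticRep hv).continuousOn
  have hae : (fun w => analyticRep W v (w + k)) =ᵐ[volume.restrict (W ∩ (fun w => w + k) ⁻¹' W)]
      fun w => c * analyticRep W v w := by
    filter_upwards [hk, ae_restrict_of_ae_restrict_of_subset inter_subset_left
      (ae_eq_analyticRep hv), (quasiMeasurePreserving_translate fun _ hw => hw.2).ae_eq_comp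
      (ae_eq_analyticRep hv)] with w hw hvw hvwk
    rw [← hvw, ← hw]
    exact hvwk.symm
  exact Measure.eqOn_open_of_ae_eq hae (hW.inter (hW.preimage (continuous_add_const k)))
    (hcont.comp (by fun_prop) fun w hw => hw.2)
    (continuousOn_const.mul (hcont.mono inter_subset_left)) ⟨hz, hz'⟩

lemma ae_add_latticePt_eq_mul_of_hasSum_nhdShift {f : L2 (periodicDomain ϖ)}
    {S : BochnerL2 (cellNhd ϖ)} (hS : HasSum (fun m => termL (cellNhd ϖ) m (nhdShift ϖ m f)) S)
    (k : ℤ × ℤ) : ∀ᵐ η ∂(volume.restrict floquetBox),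
      ∀ᵐ z ∂(volume.restrict (cellNhd ϖ ∩ (fun z => z + latticePt k) ⁻¹' cellNhd ϖ)),
        S η (z + latticePt k) = exp ((phase η k : ℂ) * I) * S η z := by
  have hk : MapsTo (fun z => z + latticePt k)
      (cellNhd ϖ ∩ (fun z => z + latticePt k) ⁻¹' cellNhd ϖ) (cellNhd ϖ) := fun _ hz => hz.2
  have hzero := mapsTo_add_zero
    (inter_subset_left (s := cellNhd ϖ) (t := (fun z => z + latticePt k) ⁻¹' cellNhd ϖ))
  have hshift : ∀ m, translateL _ hk (nhdShift ϖ m f) =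
      translateL _ hzero (nhdShift ϖ (m + k) f) := fun m => by
    refine Lp.ext ((translateL_congr hk (coeFn_translateL _ f)).trans ?_)
    refine Filter.EventuallyEq.trans ?_ (translateL_congr hzero (coeFn_translateL _ f)).symm
    exact .of_forall fun z => by simp only [latticePt_add, add_zero]; congr 1; ring
  filter_upwards [ae_eq_smul_of_hasSum_termL (translateL _ hzero) (translateL _ hk) k hshift hS]
    with η hη
  filter_upwards [coeFn_translateL hk (S η), coeFn_translateL hzero (S η),
    Lp.coeFn_smul (exp ((phase η k : ℂ) * I)) (translateL _ hzero (S η))] with z hz hz0 hsmul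
  rw [← hz, hη, hsmul, Pi.smul_apply, hz0, add_zero, smul_eq_mul]

lemma IsPeriodicCell.subset_cellNhd (h : IsPeriodicCell ϖ) : ϖ ⊆ cellNhd ϖ := fun _ hz =>
  mem_cellNhd (h.subset_periodicDomain hz) (subset_closure (h.subset_square hz))

lemma IsPeriodicCell.translateL_mem_bergmanExt (h : IsPeriodicCell ϖ) {v : L2 (cellNhd ϖ)}
    (hv : v ∈ bergmanSpace (cellNhd ϖ)) {η : ℝ × ℝ}
    (hper : ∀ k ∈ ({(1, 0), (0, 1)} : Set (ℤ × ℤ)),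
      ∀ᵐ z ∂(volume.restrict (cellNhd ϖ ∩ (fun z => z + latticePt k) ⁻¹' cellNhd ϖ)),
        v (z + latticePt k) = exp ((phase η k : ℂ) * I) * v z) :
    translateL 0 (mapsTo_add_zero h.subset_cellNhd) v ∈ bergmanExt ϖ η := by
  have hedge : ∀ k ∈ ({(1, 0), (0, 1)} : Set (ℤ × ℤ)), ∀ z ∈ periodicDomain ϖ,
      z ∈ closure unitSquare → z + latticePt k ∈ closure unitSquare →
      analyticRep (cellNhd ϖ) v (z + latticePt k) =
        exp ((phase η k : ℂ) * I) * analyticRep (cellNhd ϖ) v z := fun k hk z hz hz' hzk =>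
    analyticRep_add_eq_mul (isOpen_cellNhd ϖ) hv (hper k hk) (mem_cellNhd hz hz')
      (mem_cellNhd (add_mem_periodicDomain k hz) hzk)
  refine ⟨translateL_mem_bergmanSpace _ hv, cellNhd ϖ, analyticRep (cellNhd ϖ) v,
    isOpen_cellNhd ϖ, fun z hz => mem_cellNhd hz.2 (closure_mono h.subset_square hz.1),
    inter_subset_left, differentiableOn_analyticRep hv, ?_, fun y hy hyΩ => ?_,
    fun x hx hxΩ => ?_⟩
  · simpa only [add_zero] using
      translateL_congr (mapsTo_add_zero h.subset_cellNhd) (ae_eq_analyticRep hv)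
  · simpa [latticePt, phase, add_comm] using hedge (1, 0) (by simp) _ hyΩ
      (by simp [mem_closure_unitSquare, hy.1.le, hy.2.le])
      (by simp [mem_closure_unitSquare, hy.1.le, hy.2.le])
  · simpa [latticePt, phase] using hedge (0, 1) (by simp) _ hxΩ
      (by simp [mem_closure_unitSquare, hx.1.le, hx.2.le])
      (by simp [mem_closure_unitSquare, hx.1.le, hx.2.le])

/-- The family of translates `f(· + m)` in `L²(ϖ)` of `f` in `L²(Ω)`, as an isometry into the
Hilbert sum over the lattice. -/
noncomputable def shiftIsometry (h : IsPeriodicCell ϖ)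
    (hnull : volume (periodicDomain ϖ \ ⋃ m : ℤ × ℤ, cellTranslate ϖ m) = 0) :
    L2 (periodicDomain ϖ) →ₗᵢ[ℂ] lp (fun _ : ℤ × ℤ => L2 ϖ) 2 where
  toFun f := ⟨fun m => shift h m f,
    memℓp_gen (by simpa using (hasSum_norm_sq_shift h hnull f).summable)⟩
  map_add' f g := Subtype.ext <| funext fun m => by
    simp only [h.shift_eq_translateL, map_add]; rfl
  map_smul' c f := Subtype.ext <| funext fun m => by
    simp only [h.shift_eq_translateL, map_smul]; rfl
  norm_map' f := by
    refine (sq_eq_sq₀ (norm_nonneg _) (norm_nonneg _)).1 ?_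
    rw [← (hasSum_norm_sq_shift h hnull f).tsum_eq]
    simpa using lp.norm_rpow_eq_tsum (p := 2) (by norm_num)
      (⟨fun m => shift h m f, _⟩ : lp (fun _ : ℤ × ℤ => L2 ϖ) 2)

/-- The Floquet transform on all of `L²(Ω)`, as an isometry into the Bochner space. -/
noncomputable def floquetIsometry (h : IsPeriodicCell ϖ)
    (hnull : volume (periodicDomain ϖ \ ⋃ m : ℤ × ℤ, cellTranslate ϖ m) = 0) :
    L2 (periodicDomain ϖ) →ₗᵢ[ℂ] BochnerL2 ϖ :=
  (orthogonalFamily_termL ϖ).linearIsometry.comp (shiftIsometry h hnull)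

lemma hasSum_floquetIsometry (h : IsPeriodicCell ϖ)
    (hnull : volume (periodicDomain ϖ \ ⋃ m : ℤ × ℤ, cellTranslate ϖ m) = 0)
    (f : L2 (periodicDomain ϖ)) :
    HasSum (fun m => floquetTerm h f m) (floquetIsometry h hnull f) :=
  (orthogonalFamily_termL ϖ).hasSum_linearIsometry (shiftIsometry h hnull f)

lemma floquetIsometry_mem_bochnerBergman (h : IsPeriodicCell ϖ)
    (hnull : volume (periodicDomain ϖ \ ⋃ m : ℤ × ℤ, cellTranslate ϖ m) = 0)
    {f : L2 (periodicDomain ϖ)} (hf : f ∈ bergmanSpace (periodicDomain ϖ)) :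
    floquetIsometry h hnull f ∈ bochnerBergman ϖ := by
  obtain ⟨S, hS⟩ : Summable fun m => termL (cellNhd ϖ) m (nhdShift ϖ m f) :=
    ((orthogonalFamily_termL (cellNhd ϖ)).summable_iff_norm_sq_summable _).2
      (summable_norm_sq_nhdShift h hnull f)
  set R := translateL 0 (mapsTo_add_zero h.subset_cellNhd)
  have hmem := ae_mem_of_hasSum_termL (isClosed_bergmanSpace (isOpen_cellNhd ϖ))
    (fun m => translateL_mem_bergmanSpace _ hf) hS
  have hR : ∀ m, R (nhdShift ϖ m f) = shift h m f := fun m => by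
    rw [h.shift_eq_translateL]
    refine Lp.ext ((translateL_congr _ (coeFn_translateL _ f)).trans ?_)
    simpa only [add_zero] using (coeFn_translateL (h.mapsTo_add_latticePt m) f).symm
  have hsum := hasSum_compLpL_termL R hS
  simp only [hR] at hsum
  have hvalue := R.coeFn_compLpL (p := 2) (μ := volume.restrict floquetBox) S
  rw [hsum.unique (hasSum_floquetIsometry h hnull f)] at hvalue
  filter_upwards [hmem, hvalue, ae_add_latticePt_eq_mul_of_hasSum_nhdShift hS (1, 0),
    ae_add_latticePt_eq_mul_of_hasSum_nhdShift hS (0, 1)] with η hη hηR hη₁ hη₂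
  rw [hηR]
  exact bergmanExt_le_bergmanEta ϖ η
    (h.translateL_mem_bergmanExt hη (by rintro k (rfl | rfl); exacts [hη₁, hη₂]))

end FloquetIsometry

section Quasiperiodic

open Filter Topology

lemma eventually_mem_Icc_floor (x : ℝ) : ∀ᶠ y in 𝓝 x, x ∈ Icc (⌊y⌋ : ℝ) (⌊y⌋ + 1) := by
  filter_upwards [Ioo_mem_nhds (sub_lt_iff_lt_add.2 (Int.ceil_lt_add_one x))
    (Int.lt_floor_add_one x)] with y hy
  have hfloor : ⌊y⌋ ≤ ⌊x⌋ := Int.lt_add_one_iff.1 (Int.floor_lt.2 (by exact_mod_cast hy.2))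
  have hceil : ⌈x⌉ - 1 ≤ ⌊y⌋ := Int.le_floor.2 (by exact_mod_cast hy.1.le)
  refine ⟨(Int.cast_le.2 hfloor).trans (Int.floor_le x), (Int.le_ceil x).trans ?_⟩
  exact_mod_cast sub_le_iff_le_add.1 hceil

lemma eq_zero_or_one_of_add_mem_Icc {x : ℝ} {j : ℤ} (hx : ⌊x⌋ = 0)
    (hj : x + j ∈ Icc (0 : ℝ) 1) : j = 0 ∨ j = 1 := by
  obtain ⟨hx0, hx1⟩ := Int.floor_eq_zero_iff.1 hx
  have hlower : (-1 : ℝ) < j := by linarith [hj.1]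
  have hupper : (j : ℝ) ≤ 1 := by linarith [hj.2]
  norm_cast at hlower hupper
  lia

lemma eventually_sub_latticePt_floorIdx_mem_closure (z : ℂ) :
    ∀ᶠ w in 𝓝 z, z - latticePt (floorIdx w) ∈ closure unitSquare := by
  filter_upwards [continuous_re.continuousAt.eventually (eventually_mem_Icc_floor z.re),
    continuous_im.continuousAt.eventually (eventually_mem_Icc_floor z.im)] with w hre him
  simp only [mem_closure_unitSquare, sub_re, sub_im, latticePt_re, latticePt_im, floorIdx,
    mem_Icc, sub_nonneg, sub_le_iff_le_add']
  exact ⟨hre, him⟩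

lemma frequently_mem_Ioo {t : ℝ} (ht : t ∈ Icc (0 : ℝ) 1) : ∃ᶠ s in 𝓝[≠] t, s ∈ Ioo (0 : ℝ) 1 := by
  rcases lt_or_eq_of_le ht.2 with hlt | rfl
  · have hright : ∀ᶠ s in 𝓝[>] t, s ∈ Ioo (0 : ℝ) 1 := by
      filter_upwards [Ioo_mem_nhdsGT hlt] with s hs using ⟨ht.1.trans_lt hs.1, hs.2⟩
    exact hright.frequently.filter_mono (nhdsWithin_mono _ fun s hs => ne_of_gt hs)
  · have hleft : ∀ᶠ s in 𝓝[<] (1 : ℝ), s ∈ Ioo (0 : ℝ) 1 := Ioo_mem_nhdsLT zero_lt_one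
    exact hleft.frequently.filter_mono (nhdsWithin_mono _ fun s hs => ne_of_lt hs)

lemma eventually_eq_of_eq_on_segment {Ω : Set ℂ} (hΩ : IsOpen Ω) {F₁ F₂ : ℂ → ℂ} {a : ℂ}
    (ha : a ≠ 0) {t : ℝ} (ht : t ∈ Icc (0 : ℝ) 1) (htΩ : (t : ℂ) * a ∈ Ω)
    (hF₁ : AnalyticAt ℂ F₁ (t * a)) (hF₂ : AnalyticAt ℂ F₂ (t * a))
    (heq : ∀ s ∈ Ioo (0 : ℝ) 1, (s : ℂ) * a ∈ Ω → F₁ (s * a) = F₂ (s * a)) :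
    ∀ᶠ z in 𝓝 ((t : ℂ) * a), F₁ z = F₂ z := by
  refine (hF₁.frequently_eq_iff_eventually_eq hF₂).1 ?_
  have hline : Continuous fun s : ℝ => (s : ℂ) * a := by fun_prop
  have htendsto : Tendsto (fun s : ℝ => (s : ℂ) * a) (𝓝[≠] t) (𝓝[≠] ((t : ℂ) * a)) :=
    (hline.tendsto t).inf (tendsto_principal_principal.2 fun s hs =>
      mt (by simp [ha]) hs)
  have hmem : ∀ᶠ s : ℝ in 𝓝[≠] t, (s : ℂ) * a ∈ Ω :=
    ((hline.tendsto t).eventually (hΩ.mem_nhds htΩ)).filter_mono nhdsWithin_le_nhds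
  exact htendsto.frequently
    (((frequently_mem_Ioo ht).and_eventually hmem).mono fun s hs => heq s hs.1 hs.2)

/-- The relation `G(w + k) = e^{i η·k} G(w)` for all `w` near `z`. -/
def QuasiperiodicAt (η : ℝ × ℝ) (G : ℂ → ℂ) (k : ℤ × ℤ) (z : ℂ) : Prop :=
  ∀ᶠ w in 𝓝 z, G (w + latticePt k) = exp ((phase η k : ℂ) * I) * G w

variable {η : ℝ × ℝ} {G : ℂ → ℂ} {k l : ℤ × ℤ} {z : ℂ}

lemma quasiperiodicAt_zero (η : ℝ × ℝ) (G : ℂ → ℂ) (z : ℂ) : QuasiperiodicAt η G 0 z :=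
  .of_forall fun w => by simp

lemma QuasiperiodicAt.add (hk : QuasiperiodicAt η G k z)
    (hl : QuasiperiodicAt η G l (z + latticePt k)) : QuasiperiodicAt η G (k + l) z := by
  have hcont : Tendsto (fun w => w + latticePt k) (𝓝 z) (𝓝 (z + latticePt k)) :=
    (continuous_add_const _).tendsto z
  filter_upwards [hk, hcont.eventually hl] with w hwk hwl
  rw [latticePt_add, ← add_assoc, hwl, hwk, ← mul_assoc, ← exp_add, phase_add, ofReal_add, add_mul,
    add_comm (_ * I)]

/-- The quasiperiodic extension of a function from the unit square. -/
noncomputable def quasiExt (η : ℝ × ℝ) (G : ℂ → ℂ) (z : ℂ) : ℂ :=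
  exp ((phase η (floorIdx z) : ℂ) * I) * G (z - latticePt (floorIdx z))

lemma quasiExt_add (η : ℝ × ℝ) (G : ℂ → ℂ) (z : ℂ) (m : ℤ × ℤ) :
    quasiExt η G (z + latticePt m) = exp ((phase η m : ℂ) * I) * quasiExt η G z := by
  rw [quasiExt, quasiExt, floorIdx_add, phase_add, latticePt_add, add_sub_add_right_eq_sub,
    ← mul_assoc, ← exp_add, ofReal_add, add_mul, add_comm (_ * I)]

lemma quasiExt_add_of_mem_unitSquare (η : ℝ × ℝ) (G : ℂ → ℂ) (hz : z ∈ unitSquare) (m : ℤ × ℤ) :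
    quasiExt η G (z + latticePt m) = exp ((phase η m : ℂ) * I) * G z := by
  rw [quasiExt_add]
  simp [quasiExt, floorIdx_of_mem_unitSquare hz]

variable {ϖ : Set ℂ}
  (hG : ∀ z ∈ periodicDomain ϖ, z ∈ closure unitSquare → AnalyticAt ℂ G z)
include hG

lemma quasiperiodicAt_of_eq_on_segment {a : ℂ} (ha : a ≠ 0)
    (hedge : ∀ s ∈ Ioo (0 : ℝ) 1, (s : ℂ) * a ∈ periodicDomain ϖ →
      G (s * a + latticePt k) = exp ((phase η k : ℂ) * I) * G (s * a))
    {t : ℝ} (ht : t ∈ Icc (0 : ℝ) 1) (htΩ : (t : ℂ) * a ∈ periodicDomain ϖ)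
    (htQ : (t : ℂ) * a ∈ closure unitSquare)
    (htQ' : (t : ℂ) * a + latticePt k ∈ closure unitSquare) :
    QuasiperiodicAt η G k (t * a) := by
  refine eventually_eq_of_eq_on_segment (isOpen_periodicDomain ϖ) ha ht htΩ ?_
    (analyticAt_const.mul (hG _ htΩ htQ)) hedge
  exact AnalyticAt.fun_comp (hG _ (add_mem_periodicDomain k htΩ) htQ') (by fun_prop)

lemma quasiperiodicAt_left
    (hleft : ∀ y ∈ Ioo (0 : ℝ) 1, (y : ℂ) * I ∈ periodicDomain ϖ →
      G (1 + (y : ℂ) * I) = exp ((η.1 : ℂ) * I) * G ((y : ℂ) * I))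
    (hz : z ∈ periodicDomain ϖ) (hzQ : z ∈ closure unitSquare) {j : ℤ} (hj : j = 0 ∨ j = 1)
    (hzj : z + latticePt (j, 0) ∈ closure unitSquare) : QuasiperiodicAt η G (j, 0) z := by
  obtain rfl | rfl := hj
  · exact quasiperiodicAt_zero η G z
  have hcoord := mem_closure_unitSquare.1 hzQ
  have hcoord' := mem_closure_unitSquare.1 hzj
  simp only [add_re, latticePt_re, Int.cast_one] at hcoord'
  have hre : z.re = 0 := le_antisymm (by linarith [hcoord'.1.2]) hcoord.1.1
  have hzI : z = (z.im : ℂ) * I := by apply Complex.ext <;> simp [hre]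
  rw [hzI] at hz hzQ hzj ⊢
  refine quasiperiodicAt_of_eq_on_segment hG I_ne_zero (fun y hy hyΩ => ?_) hcoord.2 hz hzQ hzj
  simpa [latticePt, phase, add_comm] using hleft y hy hyΩ

lemma quasiperiodicAt_bottom
    (hbottom : ∀ x ∈ Ioo (0 : ℝ) 1, (x : ℂ) ∈ periodicDomain ϖ →
      G ((x : ℂ) + I) = exp ((η.2 : ℂ) * I) * G (x : ℂ))
    (hz : z ∈ periodicDomain ϖ) (hzQ : z ∈ closure unitSquare) {j : ℤ} (hj : j = 0 ∨ j = 1)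
    (hzj : z + latticePt (0, j) ∈ closure unitSquare) : QuasiperiodicAt η G (0, j) z := by
  obtain rfl | rfl := hj
  · exact quasiperiodicAt_zero η G z
  have hcoord := mem_closure_unitSquare.1 hzQ
  have hcoord' := mem_closure_unitSquare.1 hzj
  simp only [add_im, latticePt_im, Int.cast_one] at hcoord'
  have him : z.im = 0 := le_antisymm (by linarith [hcoord'.2.2]) hcoord.2.1
  have hz1 : z = (z.re : ℂ) * 1 := by apply Complex.ext <;> simp [him]
  rw [hz1] at hz hzQ hzj ⊢
  refine quasiperiodicAt_of_eq_on_segment hG one_ne_zero (fun x hx hxΩ => ?_) hcoord.1 hz hzQ hzj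
  simpa [latticePt, phase] using hbottom x hx (by simpa using hxΩ)

variable
  (hleft : ∀ y ∈ Ioo (0 : ℝ) 1, (y : ℂ) * I ∈ periodicDomain ϖ →
    G (1 + (y : ℂ) * I) = exp ((η.1 : ℂ) * I) * G ((y : ℂ) * I))
  (hbottom : ∀ x ∈ Ioo (0 : ℝ) 1, (x : ℂ) ∈ periodicDomain ϖ →
    G ((x : ℂ) + I) = exp ((η.2 : ℂ) * I) * G (x : ℂ))
include hleft hbottom

lemma quasiperiodicAt_of_add_mem_closure (hz : z ∈ periodicDomain ϖ) (hzQ : z ∈ closure unitSquare)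
    (hk₁ : k.1 = 0 ∨ k.1 = 1) (hk₂ : k.2 = 0 ∨ k.2 = 1)
    (hzk : z + latticePt k ∈ closure unitSquare) : QuasiperiodicAt η G k z := by
  have hcorner : z + latticePt (k.1, 0) ∈ closure unitSquare := by
    simpa [mem_closure_unitSquare] using
      And.intro (mem_closure_unitSquare.1 hzk).1 (mem_closure_unitSquare.1 hzQ).2
  have hk : ((k.1, 0) + (0, k.2) : ℤ × ℤ) = k := by simp
  rw [← hk]
  refine (quasiperiodicAt_left hG hleft hz hzQ hk₁ hcorner).add
    (quasiperiodicAt_bottom hG hbottom (add_mem_periodicDomain _ hz) hcorner hk₂ ?_)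
  rwa [add_assoc, ← latticePt_add, hk]

lemma quasiExt_eventuallyEq (hz : z ∈ periodicDomain ϖ) (hfloor : floorIdx z = 0) :
    quasiExt η G =ᶠ[𝓝 z] G := by
  have hnear := eventually_sub_latticePt_floorIdx_mem_closure z
  have hzQ : z ∈ closure unitSquare := by simpa [hfloor] using hnear.self_of_nhds
  have hquasi : ∀ᶠ w in 𝓝 z, ∀ k ∈ ({0, 1} ×ˢ {0, 1} : Finset (ℤ × ℤ)),
      z + latticePt k ∈ closure unitSquare →
        G (w + latticePt k) = exp ((phase η k : ℂ) * I) * G w := by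
    refine (Filter.eventually_all_finset _).2 fun k hk => Filter.eventually_imp_distrib_left.2 ?_
    simp only [Finset.mem_product, Finset.mem_insert, Finset.mem_singleton] at hk
    exact quasiperiodicAt_of_add_mem_closure hG hleft hbottom hz hzQ hk.1 hk.2
  filter_upwards [hnear, hquasi] with w hw hwk
  have hzk : z + latticePt (-floorIdx w) ∈ closure unitSquare := by
    rwa [latticePt_neg, ← sub_eq_add_neg]
  have hk : -floorIdx w ∈ ({0, 1} ×ˢ {0, 1} : Finset (ℤ × ℤ)) := by
    simp only [Finset.mem_product, Finset.mem_insert, Finset.mem_singleton]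
    obtain ⟨hre, him⟩ := mem_closure_unitSquare.1 hzk
    simp only [add_re, add_im, latticePt_re, latticePt_im] at hre him
    exact ⟨eq_zero_or_one_of_add_mem_Icc (congrArg Prod.fst hfloor) hre,
      eq_zero_or_one_of_add_mem_Icc (congrArg Prod.snd hfloor) him⟩
  rw [quasiExt, sub_eq_add_neg, ← latticePt_neg, hwk _ hk hzk, ← mul_assoc, ← exp_add, phase_neg]
  simp

lemma differentiableOn_quasiExt : DifferentiableOn ℂ (quasiExt η G) (periodicDomain ϖ) := by
  intro z hz
  set n := floorIdx z
  have hz' : z - latticePt n ∈ periodicDomain ϖ := sub_mem_periodicDomain n hz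
  have hfloor : floorIdx (z - latticePt n) = 0 := by
    rw [sub_eq_add_neg, ← latticePt_neg, floorIdx_add, add_neg_cancel]
  have hcell : DifferentiableAt ℂ (quasiExt η G) (z - latticePt n) :=
    (hG _ hz' (eventually_sub_latticePt_floorIdx_mem_closure z).self_of_nhds).differentiableAt
      |>.congr_of_eventuallyEq (quasiExt_eventuallyEq hG hleft hbottom hz' hfloor)
  have htranslate : quasiExt η G =
      fun w => exp ((phase η n : ℂ) * I) * quasiExt η G (w - latticePt n) := by
    ext w
    rw [← quasiExt_add, sub_add_cancel]
  rw [htranslate]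
  exact ((DifferentiableAt.comp (f := fun w => w - latticePt n) z hcell
    (by fun_prop)).const_mul _).differentiableWithinAt

end Quasiperiodic

section FloquetSeries

lemma tsum_enorm_ne_top {ι E : Type*} [SeminormedAddGroup E] {u : ι → E}
    (hu : Summable fun i => ‖u i‖) : ∑' i, ‖u i‖ₑ ≠ ∞ :=
  ENNReal.tsum_coe_ne_top_iff_summable.2 (NNReal.summable_coe.1 hu)

lemma hasSum_of_summable_norm_of_ae_hasSum {α E ι : Type*} [MeasurableSpace α] {μ : Measure α}
    [NormedAddCommGroup E] [CompleteSpace E] [Countable ι] {p : ℝ≥0∞} [Fact (1 ≤ p)]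
    {u : ι → Lp E p μ} {v : Lp E p μ} (hu : Summable fun i => ‖u i‖)
    (hv : ∀ᵐ x ∂μ, HasSum (fun i => u i x) (v x)) : HasSum u v := by
  have heq : v = ∑' i, u i := by
    refine Lp.ext ?_
    filter_upwards [hv, Lp.hasSum_coeFn_tsum (tsum_enorm_ne_top hu)] with x hx hx'
    exact hx.unique hx'
  exact heq ▸ hu.of_norm.hasSum

variable {ϖ : Set ℂ}

lemma IsPeriodicCell.memLp_of_ae_norm_translate_le (h : IsPeriodicCell ϖ)
    (hnull : volume (periodicDomain ϖ \ ⋃ m : ℤ × ℤ, cellTranslate ϖ m) = 0) {F : ℂ → ℂ}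
    (hF : AEStronglyMeasurable F (volume.restrict (periodicDomain ϖ))) {v : L2 ϖ}
    {c : ℤ × ℤ → ℝ} (hc : Summable c)
    (hle : ∀ m, ∀ᵐ z ∂(volume.restrict ϖ), ‖F (z + latticePt m)‖ ≤ c m * ‖v z‖) :
    MemLp F 2 (volume.restrict (periodicDomain ϖ)) := by
  have hcell : ∀ m, ∫⁻ z in ϖ, ‖F (z + latticePt m)‖ₑ ^ 2 ≤ ‖c m‖ₑ ^ 2 * ‖v‖ₑ ^ 2 := by
    intro m
    rw [enorm_sq_eq_lintegral,
      ← lintegral_const_mul' _ _ (ENNReal.pow_ne_top (enorm_ne_top (x := c m)))]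
    refine lintegral_mono_ae ?_
    filter_upwards [hle m] with z hz
    rw [← mul_pow]
    gcongr
    rw [← enorm_norm (v z), ← enorm_mul]
    exact enorm_le_iff_norm_le.2 (hz.trans (le_abs_self _))
  have hsq : ∑' m, ‖c m‖ₑ ^ 2 ≤ (∑' m, ‖c m‖ₑ) * ∑' m, ‖c m‖ₑ := by
    rw [← ENNReal.tsum_mul_left]
    refine ENNReal.tsum_le_tsum fun m => ?_
    rw [sq]
    gcongr
    exact ENNReal.le_tsum m
  refine ⟨hF, ?_⟩
  rw [eLpNorm_lt_top_iff_lintegral_rpow_enorm_lt_top two_ne_zero ENNReal.ofNat_ne_top]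
  simp only [ENNReal.toReal_ofNat, ENNReal.rpow_ofNat]
  calc ∫⁻ z in periodicDomain ϖ, ‖F z‖ₑ ^ 2
      = ∑' m, ∫⁻ z in ϖ, ‖F (z + latticePt m)‖ₑ ^ 2 := h.lintegral_periodicDomain hnull _
    _ ≤ (∑' m, ‖c m‖ₑ ^ 2) * ‖v‖ₑ ^ 2 :=
        (ENNReal.tsum_le_tsum hcell).trans_eq ENNReal.tsum_mul_right
    _ ≤ (∑' m, ‖c m‖ₑ) * (∑' m, ‖c m‖ₑ) * ‖v‖ₑ ^ 2 := by gcongr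
    _ < ∞ := by
        have hfin := (tsum_enorm_ne_top hc.norm).lt_top
        exact ENNReal.mul_lt_top (ENNReal.mul_lt_top hfin hfin) (ENNReal.pow_lt_top enorm_lt_top)

lemma IsPeriodicCell.exists_differentiableOn_quasiExt (h : IsPeriodicCell ϖ) {η : ℝ × ℝ} {v : L2 ϖ}
    (hv : v ∈ bergmanExt ϖ η) : ∃ G : ℂ → ℂ, v =ᵐ[volume.restrict ϖ] G ∧
      DifferentiableOn ℂ (quasiExt η G) (periodicDomain ϖ) := by
  obtain ⟨-, U, G, hUo, hU, -, hG, hvG, hleft, hbottom⟩ := hv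
  refine ⟨G, hvG, differentiableOn_quasiExt (fun z hz hz' => ?_) hleft hbottom⟩
  exact hG.analyticAt (hUo.mem_nhds (hU ⟨h.mem_closure hz hz', hz⟩))

lemma IsPeriodicCell.exists_hasSum_shift_of_mem_bergmanExt (h : IsPeriodicCell ϖ)
    (hnull : volume (periodicDomain ϖ \ ⋃ m : ℤ × ℤ, cellTranslate ϖ m) = 0) {η : ℝ × ℝ}
    {v : L2 ϖ} (hv : v ∈ bergmanExt ϖ η) :
    ∃ f ∈ bergmanSpace (periodicDomain ϖ), Summable (fun m => ‖shift h m f‖) ∧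
      HasSum (fun m => exp (-(phase η m : ℂ) * I) • shift h m f) v := by
  obtain ⟨G, hvG, hext⟩ := h.exists_differentiableOn_quasiExt hv
  obtain ⟨ψ, c, hψ, hc, hψc, hψ1⟩ := h.exists_analytic_partition
  set F : ℂ → ℂ := fun z => quasiExt η G z * ψ z with hF
  have hFd : DifferentiableOn ℂ F (periodicDomain ϖ) := hext.mul hψ
  have hval : ∀ m, ∀ z ∈ ϖ,
      F (z + latticePt m) = exp ((phase η m : ℂ) * I) * G z * ψ (z + latticePt m) :=
    fun m z hz => by simp only [hF, quasiExt_add_of_mem_unitSquare η G (h.subset_square hz)]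
  have hle : ∀ m, ∀ᵐ z ∂(volume.restrict ϖ), ‖F (z + latticePt m)‖ ≤ c m * ‖v z‖ := fun m => by
    filter_upwards [hvG, ae_restrict_mem h.isOpen.measurableSet] with z hvz hz
    rw [hval m z hz, hvz, norm_mul, norm_mul, norm_exp_ofReal_mul_I, one_mul, mul_comm]
    gcongr
    exact hψc m z hz
  have hmem : MemLp F 2 (volume.restrict (periodicDomain ϖ)) :=
    h.memLp_of_ae_norm_translate_le hnull (hFd.continuousOn.aestronglyMeasurable
      (isOpen_periodicDomain ϖ).measurableSet) hc hle
  set f := hmem.toLp F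
  have hshift : ∀ m, shift h m f =ᵐ[volume.restrict ϖ] fun z => F (z + latticePt m) := fun m =>
    translateL_congr (h.mapsTo_add_latticePt m) hmem.coeFn_toLp
  have hsummable : Summable fun m => ‖shift h m f‖ := by
    refine (hc.mul_right ‖v‖).of_nonneg_of_le (fun _ => norm_nonneg _) fun m => ?_
    refine Lp.norm_le_mul_norm_of_ae_le_mul ?_
    filter_upwards [hshift m, hle m] with z hz hzle
    rwa [hz]
  refine ⟨f, ⟨F, hFd, hmem.coeFn_toLp⟩, hsummable, hasSum_of_summable_norm_of_ae_hasSum ?_ ?_⟩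
  · refine hsummable.congr fun m => ?_
    rw [norm_smul, ← ofReal_neg, norm_exp_ofReal_mul_I, one_mul]
  filter_upwards [hvG, ae_restrict_mem h.isOpen.measurableSet, ae_all_iff.2 hshift,
    ae_all_iff.2 fun m => Lp.coeFn_smul (exp (-(phase η m : ℂ) * I)) (shift h m f)]
    with z hvz hz hshiftz hsmul
  have hsum := (hψ1 z hz).mul_left (G z)
  rw [mul_one, ← hvz] at hsum
  refine hsum.congr_fun fun m => ?_
  rw [hsmul, Pi.smul_apply, hshiftz, hval m z hz, smul_eq_mul, ← mul_assoc, ← mul_assoc, ← exp_add,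
    neg_mul, neg_add_cancel, exp_zero, one_mul, hvz]

end FloquetSeries

section Surjectivity

lemma exists_continuousMap_of_hasSum_termL {D : Set ℂ} {u : ℤ × ℤ → L2 D} {S : BochnerL2 D}
    (hu : Summable fun m => ‖u m‖) (hS : HasSum (fun m => termL D m (u m)) S) :
    ∃ Φ : C(ℝ × ℝ, L2 D), S =ᵐ[volume.restrict floquetBox] Φ ∧
      ∀ η, HasSum (fun m => ((1 / (2 * Real.pi) : ℂ) * exp (-(phase η m : ℂ) * I)) • u m)
        (Φ η) := by
  have hnorm : ∀ m η, ‖((1 / (2 * Real.pi) : ℂ) * exp (-(phase η m : ℂ) * I)) • u m‖ =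
      ‖(1 / (2 * Real.pi) : ℂ)‖ * ‖u m‖ := fun m η => by
    rw [norm_smul, norm_mul, ← ofReal_neg, norm_exp_ofReal_mul_I, mul_one]
  have hsummable := hu.mul_left ‖(1 / (2 * Real.pi) : ℂ)‖
  refine ⟨⟨fun η => ∑' m, ((1 / (2 * Real.pi) : ℂ) * exp (-(phase η m : ℂ) * I)) • u m,
    continuous_tsum (fun m => by fun_prop) hsummable fun m η => (hnorm m η).le⟩, ?_, fun η =>
    (Summable.of_norm (hsummable.congr fun m => (hnorm m η).symm)).hasSum⟩
  have hfin : ∑' m, ‖termL D m (u m)‖ₑ ≠ ∞ :=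
    tsum_enorm_ne_top (by simpa only [LinearIsometry.norm_map] using hu)
  rw [← hS.tsum_eq]
  refine (Lp.coeFn_tsum hfin).trans ?_
  filter_upwards [ae_all_iff.2 fun m => coeFn_termL m (u m)] with η hη
  exact tsum_congr hη

lemma ae_inner_eq_zero_of_forall_inner_mulPhase_eq_zero {D : Set ℂ} {S g : BochnerL2 D}
    {Φ : C(ℝ × ℝ, L2 D)} (hΦ : S =ᵐ[volume.restrict floquetBox] Φ)
    (horth : ∀ k, inner ℂ (mulPhase D k S) g = 0) :
    ∀ᵐ η ∂(volume.restrict floquetBox), inner ℂ (Φ η) (g η) = 0 := by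
  refine ae_eq_zero_of_forall_integral_exp_phase (s := fun η => inner ℂ (Φ η) (g η)) ?_ fun k => ?_
  · obtain ⟨C, hC⟩ := isCompact_floquetBox.exists_bound_of_continuousOn Φ.continuous.continuousOn
    refine (Lp.memLp g).of_le_mul (c := C)
      (Φ.continuous.aestronglyMeasurable.inner (Lp.memLp g).1) ?_
    filter_upwards [ae_restrict_mem isCompact_floquetBox.measurableSet] with η hη
    refine (norm_inner_le_norm _ _).trans ?_
    gcongr
    exact hC η hη
  · rw [← horth (-k), L2.inner_def]
    refine integral_congr_ae ?_
    filter_upwards [coeFn_mulPhase (-k) S, hΦ] with η hmul hη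
    rw [hmul, hη, inner_smul_left, phase_neg, ofReal_neg, conj_exp_neg_mul_I]

lemma ae_forall_mem_of_isClosed {α β : Type*} [MeasurableSpace α] {μ : Measure α}
    [TopologicalSpace β] [SecondCountableTopology β] {p : α → β → Prop}
    (hp : ∀ x, IsClosed {b | p x b}) {s : Set β} (hs : ∀ b ∈ s, ∀ᵐ x ∂μ, p x b) :
    ∀ᵐ x ∂μ, ∀ b ∈ s, p x b := by
  obtain ⟨t, htc, ht⟩ := TopologicalSpace.exists_countable_dense s
  filter_upwards [(ae_ball_iff htc).2 fun b _ => hs b b.2] with x hx b hb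
  exact ((hp x).preimage continuous_subtype_val).closure_subset_iff.2 hx (ht ⟨b, hb⟩)

variable {ϖ : Set ℂ}

lemma mulPhase_floquetIsometry (h : IsPeriodicCell ϖ)
    (hnull : volume (periodicDomain ϖ \ ⋃ m : ℤ × ℤ, cellTranslate ϖ m) = 0) (k : ℤ × ℤ)
    (f : L2 (periodicDomain ϖ)) :
    mulPhase ϖ k (floquetIsometry h hnull f) = floquetIsometry h hnull
      (translateL (latticePt k) (fun _ hz => add_mem_periodicDomain k hz) f) := by
  refine (hasSum_mulPhase_termL k (hasSum_floquetIsometry h hnull f)).unique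
    ((hasSum_floquetIsometry h hnull _).congr_fun fun m => ?_)
  change termL ϖ m (shift h (m + k) f) = termL ϖ m (shift h m _)
  simp only [h.shift_eq_translateL, latticePt_add]
  exact congrArg _ (translateL_translateL _ _ _ f).symm

lemma eq_zero_of_forall_inner_floquetIsometry_eq_zero (h : IsPeriodicCell ϖ)
    (hnull : volume (periodicDomain ϖ \ ⋃ m : ℤ × ℤ, cellTranslate ϖ m) = 0)
    {g : BochnerL2 ϖ} (hg : g ∈ bochnerBergman ϖ)
    (horth : ∀ f ∈ bergmanSpace (periodicDomain ϖ), inner ℂ (floquetIsometry h hnull f) g = 0) :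
    g = 0 := by
  have : Fact ((2 : ℝ≥0∞) ≠ ∞) := ⟨ENNReal.ofNat_ne_top⟩
  have hcontinuous : ∀ᵐ η ∂(volume.restrict floquetBox), ∀ Φ ∈ {Φ : C(ℝ × ℝ, L2 ϖ) |
      ∃ f ∈ bergmanSpace (periodicDomain ϖ),
        floquetIsometry h hnull f =ᵐ[volume.restrict floquetBox] Φ},
      inner ℂ (Φ η) (g η) = 0 := by
    refine ae_forall_mem_of_isClosed (fun η => isClosed_eq
      ((continuous_eval_const η).inner continuous_const) continuous_const) ?_
    rintro Φ ⟨f, hf, hΦ⟩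
    refine ae_inner_eq_zero_of_forall_inner_mulPhase_eq_zero hΦ fun k => ?_
    rw [mulPhase_floquetIsometry]
    exact horth _ (translateL_mem_bergmanSpace _ hf)
  refine Lp.eq_zero_iff_ae_eq_zero.2 ?_
  filter_upwards [hcontinuous, hg] with η hη hgη
  have hext : g η ∈ (bergmanExt ϖ η)ᗮ := by
    refine (Submodule.mem_orthogonal _ _).2 fun v hv => ?_
    obtain ⟨f, hf, hsummable, hfv⟩ := h.exists_hasSum_shift_of_mem_bergmanExt hnull hv
    obtain ⟨Φ, hΦ, hΦη⟩ :=
      exists_continuousMap_of_hasSum_termL hsummable (hasSum_floquetIsometry h hnull f)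
    have hvalue : Φ η = (1 / (2 * Real.pi) : ℂ) • v :=
      (hΦη η).unique (by simpa only [mul_smul] using hfv.const_smul (1 / (2 * Real.pi) : ℂ))
    have hzero := hη Φ ⟨f, hf, hΦ⟩
    rw [hvalue, inner_smul_left, mul_eq_zero] at hzero
    exact hzero.resolve_left (by simp [Real.pi_ne_zero])
  rw [← Submodule.orthogonal_closure] at hext
  exact inner_self_eq_zero.1 ((Submodule.mem_orthogonal _ _).1 hext _ hgη.1)

/-- The Floquet transform, as an isometry of `A²(Ω)` into `L²(𝐐; A²_η(ϖ))`. -/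
noncomputable def floquetTransform (h : IsPeriodicCell ϖ)
    (hnull : volume (periodicDomain ϖ \ ⋃ m : ℤ × ℤ, cellTranslate ϖ m) = 0) :
    bergmanSpace (periodicDomain ϖ) →ₗᵢ[ℂ] bochnerBergman ϖ where
  toLinearMap := (floquetIsometry h hnull).toLinearMap.restrict
    fun _ hf => floquetIsometry_mem_bochnerBergman h hnull hf
  norm_map' f := (floquetIsometry h hnull).norm_map f

lemma floquetTransform_surjective (h : IsPeriodicCell ϖ)
    (hnull : volume (periodicDomain ϖ \ ⋃ m : ℤ × ℤ, cellTranslate ϖ m) = 0) :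
    Function.Surjective (floquetTransform h hnull) := by
  have : CompleteSpace (bergmanSpace (periodicDomain ϖ)) :=
    (isClosed_bergmanSpace (isOpen_periodicDomain ϖ)).completeSpace_coe
  set K := (floquetTransform h hnull).toLinearMap.range
  have : CompleteSpace K :=
    (floquetTransform h hnull).isometry.isUniformInducing.isComplete_range.completeSpace_coe
  have hK : Kᗮ = ⊥ := by
    refine (Submodule.eq_bot_iff _).2 fun g hg => Subtype.ext ?_
    exact eq_zero_of_forall_inner_floquetIsometry_eq_zero h hnull g.2 fun f hf =>
      (Submodule.mem_orthogonal _ _).1 hg _ ⟨⟨f, hf⟩, rfl⟩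
  exact LinearMap.range_eq_top.1 (K.orthogonal_eq_bot_iff.1 hK)

end Surjectivity

section Inversion

variable {ϖ : Set ℂ}

lemma apply_shift_eq_integral (h : IsPeriodicCell ϖ)
    (hnull : volume (periodicDomain ϖ \ ⋃ m : ℤ × ℤ, cellTranslate ϖ m) = 0)
    (f : L2 (periodicDomain ϖ)) (ℓ : L2 ϖ →L[ℂ] ℂ) (n : ℤ × ℤ) :
    ℓ (shift h n f) = (1 / (2 * Real.pi) : ℂ) *
      ∫ η in floquetBox, exp ((phase η n : ℂ) * I) * ℓ (floquetIsometry h hnull f η) := by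
  set a := (InnerProductSpace.toDual ℂ (L2 ϖ)).symm ℓ
  have ha : ∀ x, inner ℂ a x = ℓ x := fun x => InnerProductSpace.toDual_symm_apply
  simp only [← ha]
  rw [← inner_termL_left, ← LinearIsometry.inner_map_map (termL ϖ n) a]
  exact (hasSum_single n fun m hm => orthogonalFamily_termL ϖ hm.symm a (shift h m f)).unique
    ((innerSL ℂ (termL ϖ n a)).hasSum (hasSum_floquetIsometry h hnull f))

lemma exists_clm_forall_mem_bergmanSpace_eq_analyticRep {D : Set ℂ} (hD : IsOpen D) {w : ℂ}
    (hw : w ∈ D) : ∃ ℓ : L2 D →L[ℂ] ℂ, ∀ f ∈ bergmanSpace D, ℓ f = analyticRep D f w := by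
  obtain ⟨r, hr, hrD⟩ := Metric.nhds_basis_closedBall.mem_iff.1 (hD.mem_nhds hw)
  exact ⟨ballAvg D w r, fun f hf => ballAvg_eq_analyticRep hr hrD hf⟩

lemma integrableOn_exp_phase_mul_analyticRep (h : IsPeriodicCell ϖ) {g : BochnerL2 ϖ}
    (hg : g ∈ bochnerBergman ϖ) {w : ℂ} (hw : w ∈ ϖ) (n : ℤ × ℤ) :
    IntegrableOn (fun η => exp ((phase η n : ℂ) * I) * analyticRep ϖ (g η) w) floquetBox := by
  obtain ⟨ℓ, hℓ⟩ := exists_clm_forall_mem_bergmanSpace_eq_analyticRep h.isOpen hw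
  have hint : Integrable (fun η => ℓ (g η)) (volume.restrict floquetBox) :=
    ℓ.integrable_comp ((Lp.memLp g).integrable one_le_two)
  have hexp : Continuous fun η => exp ((phase η n : ℂ) * I) := by fun_prop
  refine (hint.bdd_mul (c := 1) hexp.aestronglyMeasurable
    (.of_forall fun η => (norm_exp_ofReal_mul_I _).le)).congr ?_
  filter_upwards [hg] with η hη
  rw [hℓ _ hη.2]

lemma analyticRep_shift (h : IsPeriodicCell ϖ) {f : L2 (periodicDomain ϖ)}
    (hf : f ∈ bergmanSpace (periodicDomain ϖ)) (n : ℤ × ℤ) {w : ℂ} (hw : w ∈ ϖ) :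
    analyticRep ϖ (shift h n f) w = analyticRep (periodicDomain ϖ) f (w + latticePt n) := by
  have hmaps := h.mapsTo_add_latticePt n
  have hshift : shift h n f ∈ bergmanSpace ϖ := by
    rw [h.shift_eq_translateL]; exact translateL_mem_bergmanSpace hmaps hf
  refine Measure.eqOn_open_of_ae_eq ((ae_eq_analyticRep hshift).symm.trans ?_) h.isOpen
    (differentiableOn_analyticRep hshift).continuousOn
    ((differentiableOn_analyticRep hf).continuousOn.comp (by fun_prop) hmaps) hw
  exact translateL_congr hmaps (ae_eq_analyticRep hf)

lemma analyticRep_add_latticePt_eq_integral (h : IsPeriodicCell ϖ)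
    (hnull : volume (periodicDomain ϖ \ ⋃ m : ℤ × ℤ, cellTranslate ϖ m) = 0)
    {f : L2 (periodicDomain ϖ)} (hf : f ∈ bergmanSpace (periodicDomain ϖ)) {w : ℂ} (hw : w ∈ ϖ)
    (n : ℤ × ℤ) :
    analyticRep (periodicDomain ϖ) f (w + latticePt n) = (1 / (2 * Real.pi) : ℂ) *
      ∫ η in floquetBox, exp ((phase η n : ℂ) * I) *
        analyticRep ϖ (floquetIsometry h hnull f η) w := by
  obtain ⟨ℓ, hℓ⟩ := exists_clm_forall_mem_bergmanSpace_eq_analyticRep h.isOpen hw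
  have hshift : shift h n f ∈ bergmanSpace ϖ := by
    rw [h.shift_eq_translateL]; exact translateL_mem_bergmanSpace _ hf
  rw [← analyticRep_shift h hf n hw, ← hℓ _ hshift, apply_shift_eq_integral h hnull]
  congr 1
  refine integral_congr_ae ?_
  filter_upwards [floquetIsometry_mem_bochnerBergman h hnull hf] with η hη
  rw [hℓ _ hη.2]

end Inversion

end DoublyPeriodic

theorem theorem3p2_general (ϖ : Set ℂ) (hϖ : IsPeriodicCell ϖ)
    (hnull : volume (periodicDomain ϖ \ ⋃ m : ℤ × ℤ, cellTranslate ϖ m) = 0) :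
    ∃ F : bergmanSpace (periodicDomain ϖ) ≃ₗᵢ[ℂ] bochnerBergman ϖ,
      (∀ f : bergmanSpace (periodicDomain ϖ),
        HasSum (fun m : ℤ × ℤ => floquetTerm hϖ (f : L2 (periodicDomain ϖ)) m)
          (F f : BochnerL2 ϖ)) ∧
      (∀ g : bochnerBergman ϖ, ∀ z ∈ periodicDomain ϖ, z - latticePt (floorIdx z) ∈ ϖ →
        IntegrableOn (fun η : ℝ × ℝ => exp ((phase η (floorIdx z) : ℂ) * I) *
          analyticRep ϖ ((g : BochnerL2 ϖ) η) (z - latticePt (floorIdx z))) floquetBox volume ∧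
        analyticRep (periodicDomain ϖ) (F.symm g : L2 (periodicDomain ϖ)) z =
          (1 / (2 * Real.pi) : ℂ) * ∫ η in floquetBox,
            exp ((phase η (floorIdx z) : ℂ) * I) *
              analyticRep ϖ ((g : BochnerL2 ϖ) η) (z - latticePt (floorIdx z))) := by
  set F := LinearIsometryEquiv.ofSurjective (floquetTransform hϖ hnull)
    (floquetTransform_surjective hϖ hnull)
  refine ⟨F, fun f => hasSum_floquetIsometry hϖ hnull f, fun g z _ hz =>
    ⟨integrableOn_exp_phase_mul_analyticRep hϖ g.2 hz (floorIdx z), ?_⟩⟩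
  obtain ⟨f, rfl⟩ := F.surjective g
  rw [F.symm_apply_apply]
  have hinversion := analyticRep_add_latticePt_eq_integral hϖ hnull f.2 hz (floorIdx z)
  rwa [sub_add_cancel] at hinversion

theorem theorem3p2 (ϖ : Set ℂ) (hϖ : IsPeriodicCell ϖ)
    (hnull : volume (periodicDomain ϖ \ ⋃ m : ℤ × ℤ, cellTranslate ϖ m) = 0)
    (hA : ConditionA (periodicDomain ϖ)) :
    ∃ F : bergmanSpace (periodicDomain ϖ) ≃ₗᵢ[ℂ] bochnerBergman ϖ,
      (∀ f : bergmanSpace (periodicDomain ϖ),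
        HasSum (fun m : ℤ × ℤ => floquetTerm hϖ (f : L2 (periodicDomain ϖ)) m)
          (F f : BochnerL2 ϖ)) ∧
      (∀ g : bochnerBergman ϖ, ∀ z ∈ periodicDomain ϖ, z - latticePt (floorIdx z) ∈ ϖ →
        IntegrableOn (fun η : ℝ × ℝ => exp ((phase η (floorIdx z) : ℂ) * I) *
          analyticRep ϖ ((g : BochnerL2 ϖ) η) (z - latticePt (floorIdx z))) floquetBox volume ∧
        analyticRep (periodicDomain ϖ) (F.symm g : L2 (periodicDomain ϖ)) z =
          (1 / (2 * Real.pi) : ℂ) * ∫ η in floquetBox,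
            exp ((phase η (floorIdx z) : ℂ) * I) *
              analyticRep ϖ ((g : BochnerL2 ϖ) η) (z - latticePt (floorIdx z))) := by
  exact theorem3p2_general ϖ hϖ hnull
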